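/- **Setting.** Consider $N$ subsystems $\dot x_i=f_i(x,u_i)$, $u_i=g_i(x+e)$, $i\in\mathcal N=\{1,\dots,N\}$, with $x_i\in\mathbb R^{n_i}$, $x=(x_1,\dots,x_N)$, $e=(e_1,\dots,e_N)$, $e_i\in\mathbb R^{n_i}$, $u_i\in\mathbb R^{m_i}$; $\|\cdot\|$ is the Euclidean norm. Each $f_i$ is continuous, $\dot x=(f_i(x,u_i))_i$ has a local solution for every initial state and every constant input, and each $g_i$ is bounded on compact sets. Let $Z(j)$ be the set of those $i$ for which $g_i$ depends explicitly on $x_j$. A function $\alpha:\mathbb R_+\to\mathbb R_+$ is positive definite if $\alpha(r)=0\Leftrightarrow r=0$. A monotone aggregation function is a continuous $\mu:\mathbb R_+^{k}\to\mathbb R_+$ with $\mu(v)>0$ for $v\neq0$, $\mu(v)>\mu(z)$ if $v_l>z_l$ for all $l$, and $\mu(v)\to\infty$ as $\|v\|\to\infty$. **Practical ISS assumption.** For each $i$ there are a differentiable $V_i:\mathbb R^{n_i}\to\mathbb R_+$ and $\alpha_{i1},\alpha_{i2}\in\mathcal K_\infty$ with $\alpha_{i1}(\|x_i\|)\le V_i(x_i)\le\alpha_{i2}(\|x_i\|)$,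 a monotone aggregation function $\mu_i$ on $\mathbb R_+^{2N}$, functions $\gamma_{ij},\eta_{ij}\in\mathcal K_\infty\cup\{0\}$, a positive definite $\alpha_i$ and a constant $c_i>0$ such that for all $x,e$ $$V_i(x_i)\ge\max\{\mu_i(\gamma_{i1}(V_1(x_1)),\dots,\gamma_{iN}(V_N(x_N)),\eta_{i1}(\|e_1\|),\dots,\eta_{iN}(\|e_N\|)),\,c_i\}\ \Rightarrow\ \nabla V_i(x_i)f_i(x,g_i(x+e))\le-\alpha_i(\|x_i\|).$$ **Small-gain assumption (Assumption 2).** There are $\sigma\in\mathcal K_\infty^N$ and $\varphi_{ij}\in\mathcal K_\infty\cup\{0\}$ such that $\sigma$ is an $\Omega$-path for $\Gamma_\mu(s)=\big(\mu_i(\gamma_{i1}(s_1),\dots,\gamma_{iN}(s_N),0,\dots,0)\big)_i$, that is, the $\sigma_i^{-1}$ are locally Lipschitz on $(0,\infty)$, for every compact $K\subset(0,\infty)$ there are $0<a<b$ with $a\le(\sigma_i^{-1})'(r)\le b$ for all $i$ and all $r\in K$ at which $\sigma_i^{-1}$ is differentiable, and $\Gamma_\mu(\sigma(r))<\sigma(r)$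 componentwise for all $r>0$; moreover, for all $r>0$ and all $i$, $$\mu_i(\gamma_{i1}(\sigma_1(r)),\dots,\gamma_{iN}(\sigma_N(r)),\varphi_{i1}(r),\dots,\varphi_{iN}(r))<\sigma_i(r).$$ In addition $\varphi_{ij}\in\mathcal K_\infty$ whenever $i\in Z(j)$, so that $\hat\eta_j:=\max_{i\in Z(j)}\varphi_{ij}^{-1}\circ\eta_{ij}$ is defined ($\hat\eta_j:=0$ if $Z(j)=\emptyset$). **Event-triggered closed loop.** Let $\hat c_i>0$, $i\in\mathcal N$, be constants and $$T_i(x_i,e_i)=\hat\eta_i(\|e_i\|)-\max\{\sigma_i^{-1}(V_i(x_i)),\hat c_i\}.$$ A solution from $x_0$ on $[0,T)$, $0<T\le\infty$, is a continuous $x$ with $x(0)=x_0$ such that, with $t_0=0$, $\hat x(0)=x_0$ and $e=\hat x-x$: $\dot x_i=f_i(x,g_i(\hat x))$ with $\hat x$ constant between consecutive event times; $t_{k+1}=\inf\{t\in(t_k,T):\exists i,\ T_i(x_i(t),e_i(t))\ge0\}$ ($\inf\emptyset=\infty$); at time $t_{k+1}<\infty$ exactly the systems $j$ with $T_j(x_j,e_j)\ge0$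 reset $\hat x_j:=x_j(t_{k+1})$; and the solution is not continued beyond an accumulation point of the event times. It shows Zeno behaviour if the $t_k$ converge to a finite time. **Theorem.** Under these assumptions: 1. For every $x_0$ there is a solution on $[0,\infty)$. No solution on any $[0,T)$ shows Zeno behaviour, and every solution on $[0,T)$ is the restriction of a solution on $[0,\infty)$. 2. The origin is globally uniformly practically stable: there is $\beta\in\mathcal{KL}$ such that every solution, from any $x_0$, on any $[0,T)$, satisfies $\|x(t)\|\le\beta(\|x_0\|,t)+d$ for all $t\in[0,T)$, where $d=\big(\sum_i(\alpha_{i1}^{-1}(\sigma_i(\ell)))^2\big)^{1/2}$ and $\ell=\max_i\max\{\hat c_i,\sigma_i^{-1}(c_i)\}$. -/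

import Mathlib

open scoped NNReal

/-! Comparison functions on `[0, ∞)` -/

/-- Class `𝒦`: continuous, strictly increasing, zero at zero. -/
structure IsClassK (a : ℝ≥0 → ℝ≥0) : Prop where
  continuous : Continuous a
  strictMono : StrictMono a
  map_zero : a 0 = 0

/-- Class `𝒦_∞`: class `𝒦` and unbounded. -/
structure IsClassKInf (a : ℝ≥0 → ℝ≥0) : Prop extends IsClassK a where
  unbounded : Filter.Tendsto a Filter.atTop Filter.atTop

/-- Class `𝒦_∞ ∪ {0}`. -/
def IsClassKInfOrZero (a : ℝ≥0 → ℝ≥0) : Prop :=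
  IsClassKInf a ∨ a = fun _ => 0

/-- Class `𝒦ℒ`. -/
structure IsClassKL (b : ℝ≥0 → ℝ≥0 → ℝ≥0) : Prop where
  continuous : Continuous (Function.uncurry b)
  classK : ∀ s, IsClassK fun r => b r s
  antitone : ∀ r, Antitone (b r)
  tendsto : ∀ r, Filter.Tendsto (b r) Filter.atTop (nhds 0)

/-- Positive definite functions on `[0, ∞)`. -/
def IsPosDefFun (a : ℝ≥0 → ℝ≥0) : Prop :=
  ∀ r, a r = 0 ↔ r = 0

/-- The inverse of a function on `[0, ∞)`; it is the two-sided inverse for members of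
class `𝒦_∞`, and it is only used for those. -/
noncomputable def kinv (a : ℝ≥0 → ℝ≥0) : ℝ≥0 → ℝ≥0 :=
  Function.invFun a

/-- Monotone aggregation functions; nonnegativity is built into the codomain. -/
structure IsMAF {κ : Type*} [Fintype κ] (mu : (κ → ℝ≥0) → ℝ≥0) : Prop where
  continuous : Continuous mu
  pos : ∀ v, v ≠ 0 → 0 < mu v
  strict : ∀ v z, (∀ k, z k < v k) → mu z < mu v
  unbounded : Filter.Tendsto mu (Bornology.cobounded (κ → ℝ≥0)) Filter.atTop

/-! The interconnected system -/

/-- `ℝ^k` with the Euclidean norm. -/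
abbrev Euc (k : ℕ) : Type := EuclideanSpace ℝ (Fin k)

/-- The state space `ℝ^{n_1} × … × ℝ^{n_N}` with the Euclidean norm. -/
abbrev State {N : ℕ} (n : Fin N → ℕ) : Type := PiLp 2 fun i => Euc (n i)

/-- `h` depends explicitly on the block `x_j`. -/
def DependsExplicitlyOn {N : ℕ} {n : Fin N → ℕ} {W : Type*} (h : State n → W) (j : Fin N) : Prop :=
  ∃ x y : State n, (∀ k, k ≠ j → x k = y k) ∧ h x ≠ h y

/-- `Z(j)`: the systems whose controller uses the state of system `j`. -/
def receivers {N : ℕ} {n m : Fin N → ℕ} (g : ∀ i, State n → Euc (m i)) (j : Fin N) :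
    Set (Fin N) :=
  {i | DependsExplicitlyOn (g i) j}

/-- `g` is bounded on compact sets. -/
def BoundedOnCompacts {N : ℕ} {n : Fin N → ℕ} {k : ℕ} (g : State n → Euc k) : Prop :=
  ∀ K : Set (State n), IsCompact K → ∃ C : ℝ, ∀ x ∈ K, ‖g x‖ ≤ C

/-- Local existence of solutions of `ẋ_i = f_i(x, u_i)`, `i = 1, …, N`, for every initial state
and every constant input. -/
def LocallySolvable {N : ℕ} {n m : Fin N → ℕ} (f : ∀ i, State n → Euc (m i) → Euc (n i)) : Prop :=
  ∀ (x₀ : State n) (u : ∀ i, Euc (m i)), ∃ δ : ℝ, 0 < δ ∧ ∃ y : ℝ → State n,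
    y 0 = x₀ ∧ ContinuousOn y (Set.Ico 0 δ) ∧
      ∀ s ∈ Set.Ioo 0 δ, ∀ i, HasDerivAt (fun τ => y τ i) (f i (y s) (u i)) s

/-! The assumptions -/

/-- The practical ISS assumption on the subsystems `ẋ_i = f_i(x, g_i(x + e))`. -/
structure PracticalISS {N : ℕ} {n m : Fin N → ℕ}
    (f : ∀ i, State n → Euc (m i) → Euc (n i)) (g : ∀ i, State n → Euc (m i))
    (V : ∀ i, Euc (n i) → ℝ≥0) (α₁ α₂ : Fin N → ℝ≥0 → ℝ≥0)
    (mu : Fin N → (Fin N ⊕ Fin N → ℝ≥0) → ℝ≥0) (γ η : Fin N → Fin N → ℝ≥0 → ℝ≥0)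
    (α : Fin N → ℝ≥0 → ℝ≥0) (c : Fin N → ℝ≥0) : Prop where
  differentiable : ∀ i, Differentiable ℝ fun z => (V i z : ℝ)
  lower_class : ∀ i, IsClassKInf (α₁ i)
  upper_class : ∀ i, IsClassKInf (α₂ i)
  lower : ∀ i z, α₁ i ‖z‖₊ ≤ V i z
  upper : ∀ i z, V i z ≤ α₂ i ‖z‖₊
  maf : ∀ i, IsMAF (mu i)
  gain_class : ∀ i j, IsClassKInfOrZero (γ i j)
  error_gain_class : ∀ i j, IsClassKInfOrZero (η i j)
  decay_posDef : ∀ i, IsPosDefFun (α i)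
  const_pos : ∀ i, 0 < c i
  decay : ∀ (i : Fin N) (x e : State n),
    max (mu i (Sum.elim (fun j => γ i j (V j (x j))) fun j => η i j ‖e j‖₊)) (c i) ≤ V i (x i) →
      fderiv ℝ (fun z => (V i z : ℝ)) (x i) (f i x (g i (x + e))) ≤ -(α i ‖x i‖₊ : ℝ)

/-- The map `Γ̄_μ(s, w)_i = μ_i(γ_{i1}(s_1), …, γ_{iN}(s_N), w_{i1}, …, w_{iN})`. -/
def gainMapBar {N : ℕ} (mu : Fin N → (Fin N ⊕ Fin N → ℝ≥0) → ℝ≥0)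
    (γ : Fin N → Fin N → ℝ≥0 → ℝ≥0) (s : Fin N → ℝ≥0) (w : Fin N → Fin N → ℝ≥0) (i : Fin N) :
    ℝ≥0 :=
  mu i (Sum.elim (fun j => γ i j (s j)) (w i))

/-- The map `Γ_μ`: no error inputs. -/
def gainMap {N : ℕ} (mu : Fin N → (Fin N ⊕ Fin N → ℝ≥0) → ℝ≥0)
    (γ : Fin N → Fin N → ℝ≥0 → ℝ≥0) (s : Fin N → ℝ≥0) (i : Fin N) : ℝ≥0 :=
  gainMapBar mu γ s (fun _ _ => 0) i

/-- `Ω`-paths with respect to a map `Γ` on the nonnegative orthant. -/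
structure IsOmegaPath {N : ℕ} (Γ : (Fin N → ℝ≥0) → Fin N → ℝ≥0) (σ : Fin N → ℝ≥0 → ℝ≥0) :
    Prop where
  classKInf : ∀ i, IsClassKInf (σ i)
  locallyLipschitz : ∀ i, LocallyLipschitzOn (Set.Ioi 0) (kinv (σ i))
  deriv_bounds : ∀ K : Set ℝ, IsCompact K → K ⊆ Set.Ioi 0 →
    ∃ a b : ℝ, 0 < a ∧ a < b ∧ ∀ i, ∀ r ∈ K,
      DifferentiableAt ℝ (fun τ : ℝ => (kinv (σ i) τ.toNNReal : ℝ)) r →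
        a ≤ deriv (fun τ : ℝ => (kinv (σ i) τ.toNNReal : ℝ)) r ∧
          deriv (fun τ : ℝ => (kinv (σ i) τ.toNNReal : ℝ)) r ≤ b
  smallGain : ∀ r, 0 < r → ∀ i, Γ (fun j => σ j r) i < σ i r

/-- The small-gain assumption with error inputs. -/
structure SmallGainWithErrors {N : ℕ} (mu : Fin N → (Fin N ⊕ Fin N → ℝ≥0) → ℝ≥0)
    (γ : Fin N → Fin N → ℝ≥0 → ℝ≥0) (σ : Fin N → ℝ≥0 → ℝ≥0)
    (φ : Fin N → Fin N → ℝ≥0 → ℝ≥0) : Prop where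
  omegaPath : IsOmegaPath (gainMap mu γ) σ
  error_class : ∀ i j, IsClassKInfOrZero (φ i j)
  smallGain : ∀ r, 0 < r → ∀ i, gainMapBar mu γ (fun j => σ j r) (fun k j => φ k j r) i < σ i r

/-! The triggering rule -/

open Classical in
/-- `η̂_j = max_{i ∈ Z(j)} φ_{ij}⁻¹ ∘ η_{ij}`; the maximum over an empty set is `0`. -/
noncomputable def etaHat {N : ℕ} {n m : Fin N → ℕ} (g : ∀ i, State n → Euc (m i))
    (φ η : Fin N → Fin N → ℝ≥0 → ℝ≥0) (j : Fin N) (r : ℝ≥0) : ℝ≥0 :=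
  (Finset.univ.filter fun i => i ∈ receivers g j).sup fun i => kinv (φ i j) (η i j r)

/-- `T_i(x_i, e_i) = η̂_i(‖e_i‖) - max {σ_i⁻¹(V_i(x_i)), ĉ_i}`. -/
noncomputable def practicalTrigger {N : ℕ} {n m : Fin N → ℕ} (g : ∀ i, State n → Euc (m i))
    (V : ∀ i, Euc (n i) → ℝ≥0) (φ η : Fin N → Fin N → ℝ≥0 → ℝ≥0)
    (σ : Fin N → ℝ≥0 → ℝ≥0) (cHat : Fin N → ℝ≥0) (i : Fin N) (xi ei : Euc (n i)) : ℝ :=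
  (etaHat g φ η i ‖ei‖₊ : ℝ) - (max (kinv (σ i) (V i xi)) (cHat i) : ℝ≥0)

/-! Solutions of the event-triggered closed loop -/

/-- `x` is a solution on `[0, T)`, `0 < T ≤ ∞`, of the event-triggered closed loop
`ẋ_i = f_i(x, g_i(x̂))`, `e = x̂ - x`, with triggering condition `Tr_i(x_i, e_i) ≥ 0`, started at
`x₀` with `e = 0`.  Here `t 0 = 0`, `t k` is the `k`-th event time (`⊤` if there are fewer than
`k` events before `T`), and `xh k` is the value of `x̂` held after the `k`-th event. -/
structure IsEventTriggeredSolution {N : ℕ} {n m : Fin N → ℕ}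
    (f : ∀ i, State n → Euc (m i) → Euc (n i)) (g : ∀ i, State n → Euc (m i))
    (Tr : ∀ i, Euc (n i) → Euc (n i) → ℝ) (x₀ : State n) (T : EReal)
    (x : ℝ → State n) (t : ℕ → EReal) (xh : ℕ → State n) : Prop where
  pos : 0 < T
  init : x 0 = x₀
  continuousOn : ContinuousOn x {s : ℝ | 0 ≤ s ∧ (s : EReal) < T}
  time_zero : t 0 = 0
  held_zero : xh 0 = x₀
  /-- the next event: `t_{k+1} = inf {s > t_k : ∃ i, Tr_i(x_i(s), e_i(s)) ≥ 0}` -/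
  time_succ : ∀ k, t (k + 1) = sInf ((fun s : ℝ => (s : EReal)) ''
    {s : ℝ | t k < s ∧ (s : EReal) < T ∧ ∃ i, 0 ≤ Tr i (x s i) (xh k i - x s i)})
  /-- at an event exactly the systems whose triggering condition holds broadcast their state -/
  held_succ : ∀ (k : ℕ) (s : ℝ), t (k + 1) = s → ∀ i,
    (0 ≤ Tr i (x s i) (xh k i - x s i) → xh (k + 1) i = x s i) ∧
      (¬ 0 ≤ Tr i (x s i) (xh k i - x s i) → xh (k + 1) i = xh k i)
  /-- the solution does not go beyond an accumulation point of the event times -/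
  covered : ∀ s : ℝ, (s : EReal) < T → ∃ k, (s : EReal) < t k
  ode : ∀ (k : ℕ) (s : ℝ), t k < s → (s : EReal) < t (k + 1) → (s : EReal) < T →
    ∀ i, HasDerivAt (fun τ => x τ i) (f i (x s) (g i (xh k))) s

/-- Zeno behaviour: the event times converge to a finite time. -/
def IsZeno (t : ℕ → EReal) : Prop :=
  ∃ tStar : ℝ, Filter.Tendsto t Filter.atTop (nhds (tStar : EReal))

/-- The origin of the event-triggered closed loop is globally uniformly practically stable, with
residual radius `d`: `‖x(s)‖ ≤ β(‖x₀‖, s) + d` with one `β` of class `𝒦ℒ` for all solutions. -/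
def IsGloballyUniformlyPracticallyStable {N : ℕ} {n m : Fin N → ℕ}
    (f : ∀ i, State n → Euc (m i) → Euc (n i)) (g : ∀ i, State n → Euc (m i))
    (Tr : ∀ i, Euc (n i) → Euc (n i) → ℝ) (d : ℝ≥0) : Prop :=
  ∃ β : ℝ≥0 → ℝ≥0 → ℝ≥0, IsClassKL β ∧
    ∀ (x₀ : State n) (T : EReal) (x : ℝ → State n) (t : ℕ → EReal) (xh : ℕ → State n),
      IsEventTriggeredSolution f g Tr x₀ T x t xh →
        ∀ s : ℝ≥0, ((s : ℝ) : EReal) < T → ‖x s‖₊ ≤ β ‖x₀‖₊ s + d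

/-- The level `max_i {ĉ_i, σ_i⁻¹(c_i)}` of the Lyapunov function `max_i σ_i⁻¹(V_i(x_i))`. -/
noncomputable def residualLevel {N : ℕ} (σ : Fin N → ℝ≥0 → ℝ≥0) (c cHat : Fin N → ℝ≥0) : ℝ≥0 :=
  Finset.univ.sup fun i => max (cHat i) (kinv (σ i) (c i))

/-- `(∑_i (α_{i1}⁻¹(σ_i(ℓ)))²)^{1/2}`, where `ℓ` is the residual level: a bound for `‖x‖` on the
sublevel set of the Lyapunov function at that level. -/
noncomputable def residualRadius {N : ℕ} (α₁ σ : Fin N → ℝ≥0 → ℝ≥0) (c cHat : Fin N → ℝ≥0) :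
    ℝ≥0 :=
  NNReal.sqrt (∑ i, kinv (α₁ i) (σ i (residualLevel σ c cHat)) ^ 2)

/-! Let `W = lyap V σ` and let `ℓ` be the residual level. Between events no trigger is positive, so
`η̂_j(‖e_j‖) ≤ max(σ_j⁻¹(V_j), ĉ_j)`, which is at most `W` wherever `W > ℓ`. Hence `η_ij(‖e_j‖) ≤
φ_ij(W)` for every block `j` that controller `i` uses. For an index `i` attaining the maximum in
`W`, the strict small-gain inequality then puts the aggregated gains below `σ_i(W) = V_i`, and `c_i
≤ V_i` because `W > ℓ`. The ISS implication makes `V_i` decrease, while the other indices stay below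
`W` for a short time. So `W` decreases above `ℓ`.

The `V_i` are only differentiable, the `α_i` only positive definite and the `g_i` only bounded on
compact sets, so no differential inequality for `W` is integrated. Instead the derivative of `V_i`
is frozen at one state: continuity of `f_i` shows that all arcs starting nearby lose a definite
amount of `W` in a short time (`eventually_lyap_le`). This gives invariance of sublevel sets
(`lyap_le_along_arc`). Compactness of `{b ≤ W ≤ a}` makes the loss uniform
(`exists_uniform_decrease`), and counting losses bounds the time to reach `{W ≤ b}`
(`exists_uniform_time`). Invariance and uniform attraction yield the `𝒦ℒ` estimate through
`exists_isClassKL_majorant`.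

Since `ĉ_i > 0`, an event of system `i` needs an error of at least some fixed `ρ > 0`. Solutions and
held states stay in a compact sublevel set, so velocities are bounded and a system that has just
reset cannot trigger again too soon; finitely many systems then produce no accumulation of events.
Bounded velocity also gives a limit at a finite end time, from which a local solution continues the
motion (`exists_extension`), and Zorn's lemma leads to `[0, ∞)`. -/

open Filter Topology Set

/-! ### Comparison and aggregation functions -/

namespace IsClassKInf

variable {a b : ℝ≥0 → ℝ≥0}

theorem surjective (ha : IsClassKInf a) : Function.Surjective a := by
  intro r
  obtain ⟨s, hs⟩ := (ha.unbounded.eventually_ge_atTop r).exists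
  exact mem_range_of_exists_le_of_exists_ge ha.continuous
    ⟨0, by rw [ha.map_zero]; exact zero_le⟩ ⟨s, hs⟩

theorem kinv_apply (ha : IsClassKInf a) (r : ℝ≥0) : kinv a (a r) = r :=
  Function.leftInverse_invFun ha.strictMono.injective r

theorem apply_kinv (ha : IsClassKInf a) (r : ℝ≥0) : a (kinv a r) = r :=
  Function.rightInverse_invFun ha.surjective r

theorem kinv_strictMono (ha : IsClassKInf a) : StrictMono (kinv a) := fun r s h => by
  rw [← ha.strictMono.lt_iff_lt, ha.apply_kinv, ha.apply_kinv]
  exact h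

theorem kinv_le_iff (ha : IsClassKInf a) {r s : ℝ≥0} : kinv a r ≤ s ↔ r ≤ a s := by
  rw [← ha.strictMono.le_iff_le, ha.apply_kinv]

theorem le_kinv_iff (ha : IsClassKInf a) {r s : ℝ≥0} : s ≤ kinv a r ↔ a s ≤ r := by
  rw [← ha.strictMono.le_iff_le, ha.apply_kinv]

theorem kinv_lt_iff (ha : IsClassKInf a) {r s : ℝ≥0} : kinv a r < s ↔ r < a s := by
  rw [← ha.strictMono.lt_iff_lt, ha.apply_kinv]

theorem isClassKInf_kinv (ha : IsClassKInf a) : IsClassKInf (kinv a) where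
  continuous := ha.kinv_strictMono.monotone.continuous_of_surjective
    fun r => ⟨a r, ha.kinv_apply r⟩
  strictMono := ha.kinv_strictMono
  map_zero := by rw [← ha.map_zero, ha.kinv_apply, ha.map_zero]
  unbounded := ha.kinv_strictMono.monotone.tendsto_atTop_atTop
    fun r => ⟨a r, (ha.kinv_apply r).ge⟩

theorem comp (ha : IsClassKInf a) (hb : IsClassKInf b) : IsClassKInf fun r => a (b r) where
  continuous := ha.continuous.comp hb.continuous
  strictMono := ha.strictMono.comp hb.strictMono
  map_zero := by rw [hb.map_zero, ha.map_zero]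
  unbounded := ha.unbounded.comp hb.unbounded

theorem pos (ha : IsClassKInf a) {r : ℝ≥0} (hr : 0 < r) : 0 < a r := by
  simpa [ha.map_zero] using ha.strictMono hr

end IsClassKInf

namespace IsClassKInfOrZero

variable {a : ℝ≥0 → ℝ≥0}

theorem continuous (ha : IsClassKInfOrZero a) : Continuous a := by
  rcases ha with h | rfl
  · exact h.continuous
  · exact continuous_const

theorem monotone (ha : IsClassKInfOrZero a) : Monotone a := by
  rcases ha with h | rfl
  · exact h.strictMono.monotone
  · exact monotone_const

theorem map_zero (ha : IsClassKInfOrZero a) : a 0 = 0 := by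
  rcases ha with h | rfl
  · exact h.map_zero
  · rfl

end IsClassKInfOrZero

/-- Strict monotonicity applies only when every component increases; raising all components of `v`
by `ε` and letting `ε → 0` removes this restriction. -/
theorem IsMAF.monotone {κ : Type*} [Fintype κ] {mu : (κ → ℝ≥0) → ℝ≥0} (h : IsMAF mu) :
    Monotone mu := by
  intro z v hzv
  have hlim : Tendsto (fun ε : ℝ≥0 => mu fun k => v k + ε) (𝓝[>] 0) (𝓝 (mu v)) := by
    have hc : Continuous fun ε : ℝ≥0 => mu fun k => v k + ε := h.continuous.comp (by fun_prop)
    have := (hc.tendsto 0).mono_left (nhdsWithin_le_nhds (s := Ioi 0))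
    simpa using this
  refine ge_of_tendsto hlim ?_
  filter_upwards [self_mem_nhdsWithin] with ε hε
  exact (h.strict _ _ fun k => lt_of_le_of_lt (hzv k) (lt_add_of_pos_right _ hε)).le

/-! Majorization by functions of class `𝒦ℒ` -/

/-- The moving average of `Θ` over `[t - 1, t]` works: it is a difference of primitives, hence
continuous, and lies between the values of `Θ` at the two endpoints. -/
theorem Antitone.exists_continuous_majorant {Θ : ℝ → ℝ} (hΘ : Antitone Θ) :
    ∃ G : ℝ → ℝ, Continuous G ∧ Antitone G ∧ ∀ t, Θ t ≤ G t ∧ G t ≤ Θ (t - 1) := by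
  have hint : ∀ a b, IntervalIntegrable Θ MeasureTheory.volume a b := fun a b =>
    hΘ.intervalIntegrable
  have hshift : ∀ t, ∫ v in (t - 1)..t, Θ v = ∫ v in (0 : ℝ)..1, Θ (v + (t - 1)) := by
    intro t
    rw [intervalIntegral.integral_comp_add_right]
    congr 1 <;> ring
  have hanti : ∀ c : ℝ, Antitone fun v => Θ (v + c) := fun c v w h => hΘ (by linarith)
  refine ⟨fun t => ∫ v in (t - 1)..t, Θ v, ?_, ?_, ?_⟩
  · have h1 : Continuous fun t => ∫ v in (0 : ℝ)..t, Θ v :=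
      intervalIntegral.continuous_primitive hint 0
    have h2 : (fun t => ∫ v in (t - 1)..t, Θ v) =
        fun t => (∫ v in (0 : ℝ)..t, Θ v) - ∫ v in (0 : ℝ)..(t - 1), Θ v := by
      funext t
      rw [intervalIntegral.integral_interval_sub_left (hint _ _) (hint _ _)]
    rw [h2]
    exact h1.sub (h1.comp (continuous_id.sub continuous_const))
  · intro s t hst
    simp only [hshift]
    exact intervalIntegral.integral_mono_on zero_le_one (hanti _).intervalIntegrable
      (hanti _).intervalIntegrable fun v _ => hΘ (by linarith)
  · intro t
    simp only [hshift]
    constructor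
    · have := intervalIntegral.integral_mono_on (μ := MeasureTheory.volume) (f := fun _ => Θ t)
        (g := fun v => Θ (v + (t - 1))) zero_le_one intervalIntegrable_const
        (hanti _).intervalIntegrable fun v hv => hΘ (by linarith [hv.2])
      simpa using this
    · have := intervalIntegral.integral_mono_on (μ := MeasureTheory.volume)
        (f := fun v => Θ (v + (t - 1))) (g := fun _ => Θ (t - 1)) zero_le_one
        (hanti _).intervalIntegrable intervalIntegrable_const
        fun v hv => hΘ (by linarith [hv.1])
      simpa using this

/-- Countably many antitone functions that tend to zero are, up to constants, bounded by a
single one. -/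
theorem exists_common_decay {F : ℕ → ℝ → ℝ} (hF : ∀ n, Antitone (F n))
    (hpos : ∀ n t, 0 ≤ F n t) {C : ℕ → ℝ} (hC : ∀ n t, F n t ≤ C n)
    (hlim : ∀ n, Tendsto (F n) atTop (𝓝 0)) :
    ∃ θ : ℝ → ℝ, Antitone θ ∧ Tendsto θ atTop (𝓝 0) ∧
      ∀ n t, F n t ≤ 2 ^ n * (1 + C n) * θ t := by
  have hC0 : ∀ n, 0 < 1 + C n := fun n => by linarith [(hpos n 0).trans (hC n 0)]
  have hterm0 : ∀ t n, 0 ≤ (1 / 2 : ℝ) ^ n * (F n t / (1 + C n)) := fun t n =>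
    mul_nonneg (by positivity) (div_nonneg (hpos n t) (hC0 n).le)
  have hterm : ∀ t n, (1 / 2 : ℝ) ^ n * (F n t / (1 + C n)) ≤ (1 / 2 : ℝ) ^ n := fun t n =>
    mul_le_of_le_one_right (by positivity)
      ((div_le_one (hC0 n)).2 (by linarith [hC n t]))
  have hsum : ∀ t, Summable fun n => (1 / 2 : ℝ) ^ n * (F n t / (1 + C n)) := fun t =>
    Summable.of_nonneg_of_le (hterm0 t) (hterm t) summable_geometric_two
  -- The weights `2⁻ⁿ / (1 + C n)` put the series under the geometric one, so dominated convergence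
  -- gives the limit zero, and each single term is recovered up to its weight.
  refine ⟨fun t => ∑' n, (1 / 2 : ℝ) ^ n * (F n t / (1 + C n)), ?_, ?_, ?_⟩
  · intro s t hst
    refine (hsum t).tsum_le_tsum (fun n => ?_) (hsum s)
    have := hF n hst
    have := hC0 n
    gcongr
  · have := tendsto_tsum_of_dominated_convergence (𝓕 := atTop)
      (f := fun t n => (1 / 2 : ℝ) ^ n * (F n t / (1 + C n))) (g := fun _ => 0)
      summable_geometric_two (fun n => by
        simpa using ((hlim n).div_const (1 + C n)).const_mul ((1 / 2 : ℝ) ^ n))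
      (Eventually.of_forall fun t n => by
        rw [Real.norm_of_nonneg (hterm0 t n)]; exact hterm t n)
    simpa using this
  · intro n t
    have h1 := (hsum t).le_tsum n fun j _ => hterm0 t j
    have h2 : F n t = 2 ^ n * (1 + C n) * ((1 / 2 : ℝ) ^ n * (F n t / (1 + C n))) := by
      have := (hC0 n).ne'
      have h3 : (2 : ℝ) ^ n * (1 / 2) ^ n = 1 := by rw [← mul_pow]; norm_num
      field_simp
      rw [mul_assoc, h3, mul_one]
    rw [h2]
    exact mul_le_mul_of_nonneg_left (by simpa [← h2] using h1)
      (mul_nonneg (by positivity) (hC0 n).le)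

/-- A family of estimates `R r t e` (read: "`e` occurs at time `t` from size `r`") that is bounded
by a function of class `𝒦` and decays uniformly for bounded `r` is bounded by a function of class
`𝒦ℒ`. -/
theorem exists_isClassKL_majorant {A : ℝ≥0 → ℝ≥0} (hA : Continuous A) (hmono : Monotone A)
    (h0 : A 0 = 0) {R : ℝ≥0 → ℝ≥0 → ℝ≥0 → Prop} (hbd : ∀ r t e, R r t e → e ≤ A r)
    (hconv : ∀ r ε, 0 < ε → ∃ T, ∀ r' ≤ r, ∀ t ≥ T, ∀ e, R r' t e → e ≤ ε) :
    ∃ β, IsClassKL β ∧ ∀ r t e, R r t e → e ≤ β r t := by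
  -- Taking all times from `t` on makes the supremum antitone in `t`; the extra element `0` keeps
  -- the set nonempty.
  let S : ℕ → ℝ → Set ℝ≥0 := fun n t =>
    {e | e = 0 ∨ ∃ r' ≤ (n : ℝ≥0), ∃ t' : ℝ≥0, t ≤ t' ∧ R r' t' e}
  have hSle : ∀ n t, ∀ e ∈ S n t, e ≤ A n := by
    rintro n t e (rfl | ⟨r', hr', t', -, h⟩)
    · exact zero_le
    · exact (hbd _ _ _ h).trans (hmono hr')
  have hSbdd : ∀ n t, BddAbove (S n t) := fun n t => ⟨A n, hSle n t⟩
  have hSne : ∀ n t, (S n t).Nonempty := fun n t => ⟨0, Or.inl rfl⟩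
  -- Square roots split `e = √e · √e`: one factor is bounded by `√(A r)` and vanishes at `r = 0`,
  -- the other carries the decay in time.
  let F : ℕ → ℝ → ℝ := fun n t => (NNReal.sqrt (sSup (S n t)) : ℝ)
  have hFanti : ∀ n, Antitone (F n) := by
    intro n s t hst
    refine NNReal.coe_le_coe.2 (NNReal.sqrt_le_sqrt.2 (csSup_le_csSup (hSbdd n s) (hSne n t) ?_))
    rintro e (h | ⟨r', hr', t', ht', h⟩)
    · exact Or.inl h
    · exact Or.inr ⟨r', hr', t', hst.trans ht', h⟩
  have hFlim : ∀ n, Tendsto (F n) atTop (𝓝 0) := by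
    intro n
    have h1 : Tendsto (fun t => sSup (S n t)) atTop (𝓝 0) := by
      refine tendsto_order.2 ⟨fun a ha => absurd ha not_lt_zero, fun ε hε => ?_⟩
      obtain ⟨T, hT⟩ := hconv n (ε / 2) (half_pos hε)
      filter_upwards [eventually_ge_atTop (T : ℝ)] with t ht
      refine (csSup_le (hSne n t) ?_).trans_lt (NNReal.half_lt_self hε.ne')
      rintro e (rfl | ⟨r', hr', t', ht', h⟩)
      · exact zero_le
      · exact hT r' hr' t' (NNReal.coe_le_coe.1 (ht.trans ht')) e h
    have h2 := (NNReal.continuous_sqrt.tendsto 0).comp h1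
    have h3 := (NNReal.continuous_coe.tendsto _).comp h2
    simpa [F, Function.comp_def] using h3
  obtain ⟨θ, hθa, hθl, hθ⟩ := exists_common_decay hFanti (fun n t => NNReal.coe_nonneg _)
    (C := fun n => (NNReal.sqrt (A n) : ℝ))
    (fun n t => NNReal.coe_le_coe.2 (NNReal.sqrt_le_sqrt.2 (csSup_le (hSne n t) (hSle n t)))) hFlim
  obtain ⟨G, hGc, hGa, hG⟩ := hθa.exists_continuous_majorant
  have hGlim : Tendsto G atTop (𝓝 0) :=
    tendsto_of_tendsto_of_tendsto_of_le_of_le hθl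
      (hθl.comp (tendsto_atTop_add_const_right _ (-1) tendsto_id))
      (fun t => (hG t).1) (fun t => (hG t).2)
  -- The constants of the common decay, as a function of `u = -r`, so that the majorant for antitone
  -- functions applies.
  let Ψ : ℝ → ℝ := fun u => 2 ^ ⌈-u⌉₊ * (1 + (NNReal.sqrt (A ⌈-u⌉₊) : ℝ))
  have hΨ : Antitone Ψ := by
    intro u v huv
    have h1 : ⌈-v⌉₊ ≤ ⌈-u⌉₊ := Nat.ceil_mono (by linarith)
    have h2 : NNReal.sqrt (A ⌈-v⌉₊) ≤ NNReal.sqrt (A ⌈-u⌉₊) :=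
      NNReal.sqrt_le_sqrt.2 (hmono (by exact_mod_cast h1))
    have h3 : (2 : ℝ) ^ ⌈-v⌉₊ ≤ 2 ^ ⌈-u⌉₊ := pow_le_pow_right₀ (by norm_num) h1
    have h4 : (NNReal.sqrt (A ⌈-v⌉₊) : ℝ) ≤ NNReal.sqrt (A ⌈-u⌉₊) := h2
    exact mul_le_mul h3 (by linarith) (by positivity) (by positivity)
  obtain ⟨H, hHc, hHa, hH⟩ := hΨ.exists_continuous_majorant
  -- The product alone need not be strictly increasing in `r`; the summand `r / (1 + t)` supplies
  -- this.
  refine ⟨fun r t => NNReal.sqrt (A r) * (H (-r)).toNNReal * (G t).toNNReal + r / (1 + t),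
    ⟨?_, ?_, ?_, ?_⟩, ?_⟩
  · have hc : Continuous fun p : ℝ≥0 × ℝ≥0 => p.1 / (1 + p.2) :=
      continuous_fst.div₀ (by fun_prop) (fun p => by positivity)
    have h1 : Continuous fun p : ℝ≥0 × ℝ≥0 => NNReal.sqrt (A p.1) :=
      NNReal.continuous_sqrt.comp (hA.comp continuous_fst)
    have h2 : Continuous fun p : ℝ≥0 × ℝ≥0 => (H (-p.1)).toNNReal :=
      continuous_real_toNNReal.comp (hHc.comp (by fun_prop))
    have h3 : Continuous fun p : ℝ≥0 × ℝ≥0 => (G p.2).toNNReal :=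
      continuous_real_toNNReal.comp (hGc.comp (by fun_prop))
    exact ((h1.mul h2).mul h3).add hc
  · intro t
    refine ⟨?_, ?_, ?_⟩
    · refine Continuous.add (Continuous.mul (Continuous.mul
        (NNReal.continuous_sqrt.comp hA)
        (continuous_real_toNNReal.comp (hHc.comp (by fun_prop)))) continuous_const)
        (continuous_id.div_const _)
    · intro r s hrs
      refine add_lt_add_of_le_of_lt ?_ ?_
      · gcongr
        · exact hmono hrs.le
        · exact hHa (neg_le_neg (NNReal.coe_le_coe.2 hrs.le))
      · exact div_lt_div_of_pos_right hrs (by positivity)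
    · simp [h0]
  · intro r s t hst
    dsimp only
    gcongr
    exact hGa (by exact_mod_cast hst)
  · intro r
    have h1 : Tendsto (fun t : ℝ≥0 => (G t).toNNReal) atTop (𝓝 0) := by
      have := (continuous_real_toNNReal.tendsto 0).comp
        (hGlim.comp (NNReal.tendsto_coe_atTop.2 tendsto_id))
      simpa [Function.comp_def] using this
    have h2 : Tendsto (fun t : ℝ≥0 => r / (1 + t)) atTop (𝓝 0) := by
      rw [← NNReal.tendsto_coe]
      push_cast
      exact Tendsto.div_atTop tendsto_const_nhds
        (tendsto_atTop_add_const_left _ _ (NNReal.tendsto_coe_atTop.2 tendsto_id))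
    simpa using (h1.const_mul (NNReal.sqrt (A r) * (H (-r)).toNNReal)).add h2
  · intro r t e h
    refine le_add_right ?_
    set n := ⌈(r : ℝ)⌉₊
    have hrn : r ≤ n := by exact_mod_cast Nat.le_ceil (r : ℝ)
    have he : e ≤ sSup (S n t) := le_csSup (hSbdd n t) (Or.inr ⟨r, hrn, t, le_rfl, h⟩)
    have h1 : (NNReal.sqrt e : ℝ) ≤ H (-r) * G t := by
      calc (NNReal.sqrt e : ℝ) ≤ F n t := NNReal.coe_le_coe.2 (NNReal.sqrt_le_sqrt.2 he)
        _ ≤ _ := hθ n t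
        _ ≤ H (-r) * G t := by
          refine mul_le_mul ?_ (hG t).1 ?_ ?_
          · have := (hH (-r)).1
            simpa [Ψ] using this
          · exact hθa.le_of_tendsto hθl t
          · exact le_trans (by positivity) (hH (-r)).1
    have hG0 : 0 ≤ G t := hGa.le_of_tendsto hGlim t
    have hH0 : 0 ≤ H (-r) := le_trans (by positivity) (hH (-r)).1
    have h2 : NNReal.sqrt e ≤ (H (-r)).toNNReal * (G t).toNNReal := by
      rw [← NNReal.coe_le_coe, NNReal.coe_mul, Real.coe_toNNReal _ hH0, Real.coe_toNNReal _ hG0]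
      exact h1
    calc e = NNReal.sqrt e * NNReal.sqrt e := (NNReal.mul_self_sqrt e).symm
      _ ≤ NNReal.sqrt (A r) * ((H (-r)).toNNReal * (G t).toNNReal) :=
        mul_le_mul' (NNReal.sqrt_le_sqrt.2 (hbd _ _ _ h)) h2
      _ = _ := (mul_assoc _ _ _).symm

/-! ### Assumptions, Lyapunov function and untriggered arcs -/

/-- The standing assumptions on the interconnection. -/
structure StandingAssumptions {N : ℕ} {n m : Fin N → ℕ}
    (f : ∀ i, State n → Euc (m i) → Euc (n i)) (g : ∀ i, State n → Euc (m i))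
    (V : ∀ i, Euc (n i) → ℝ≥0) (α₁ α₂ : Fin N → ℝ≥0 → ℝ≥0)
    (mu : Fin N → (Fin N ⊕ Fin N → ℝ≥0) → ℝ≥0) (γ η : Fin N → Fin N → ℝ≥0 → ℝ≥0)
    (α : Fin N → ℝ≥0 → ℝ≥0) (c : Fin N → ℝ≥0)
    (σ : Fin N → ℝ≥0 → ℝ≥0) (φ : Fin N → Fin N → ℝ≥0 → ℝ≥0) (cHat : Fin N → ℝ≥0) : Prop where
  continuous_field : ∀ i, Continuous fun p : State n × Euc (m i) => f i p.1 p.2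
  locallySolvable : LocallySolvable f
  boundedOnCompacts : ∀ i, BoundedOnCompacts (g i)
  iss : PracticalISS f g V α₁ α₂ mu γ η α c
  gain : SmallGainWithErrors mu γ σ φ
  receivers_class : ∀ i j, i ∈ receivers g j → IsClassKInf (φ i j)
  cHat_pos : ∀ i, 0 < cHat i

/-- The right-hand side of the closed loop at state `x` and held state `h`. -/
noncomputable def heldField {N : ℕ} {n m : Fin N → ℕ} (f : ∀ i, State n → Euc (m i) → Euc (n i))
    (g : ∀ i, State n → Euc (m i)) (x h : State n) : State n :=
  WithLp.toLp 2 fun i => f i x (g i h)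

/-- The Lyapunov function `max_i σ_i⁻¹(V_i(x_i))`. -/
noncomputable def lyap {N : ℕ} {n : Fin N → ℕ} (V : ∀ i, Euc (n i) → ℝ≥0)
    (σ : Fin N → ℝ≥0 → ℝ≥0) (x : State n) : ℝ≥0 :=
  Finset.univ.sup fun i => kinv (σ i) (V i (x i))

/-- Arcs on `[a, b]` whose held states lie in `K` and along which no system is over its
triggering threshold. -/
def IsUntriggeredArc {N : ℕ} {n m : Fin N → ℕ} (f : ∀ i, State n → Euc (m i) → Euc (n i))
    (g : ∀ i, State n → Euc (m i)) (Tr : ∀ i, Euc (n i) → Euc (n i) → ℝ)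
    (K : Set (State n)) (a b : ℝ) (y : ℝ → State n) : Prop :=
  ContinuousOn y (Icc a b) ∧ ∀ s ∈ Ico a b, ∃ h ∈ K, (∀ i, Tr i (y s i) (h i - y s i) ≤ 0) ∧
    HasDerivWithinAt y (heldField f g (y s) h) (Ici s) s

theorem IsUntriggeredArc.mono {N : ℕ} {n m : Fin N → ℕ}
    {f : ∀ i, State n → Euc (m i) → Euc (n i)} {g : ∀ i, State n → Euc (m i)}
    {Tr : ∀ i, Euc (n i) → Euc (n i) → ℝ} {K K' : Set (State n)} {a b a' b' : ℝ}
    {y : ℝ → State n} (h : IsUntriggeredArc f g Tr K a b y) (hK : K ⊆ K') (ha : a ≤ a')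
    (hb : b' ≤ b) : IsUntriggeredArc f g Tr K' a' b' y := by
  refine ⟨h.1.mono (Icc_subset_Icc ha hb), fun s hs => ?_⟩
  obtain ⟨z, hz, h1, h2⟩ := h.2 s (Ico_subset_Ico ha hb hs)
  exact ⟨z, hK hz, h1, h2⟩

/-- Replace the blocks of `x` by those of `y` one at a time: a block that `g i` uses does not
change, and changing any other block leaves the value of `g i` alone. -/
theorem eq_of_eq_on_receivers {N : ℕ} {n m : Fin N → ℕ} {g : ∀ i, State n → Euc (m i)}
    {i : Fin N} {x y : State n} (h : ∀ j, i ∈ receivers g j → x j = y j) : g i x = g i y := by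
  classical
  have key : ∀ s : Finset (Fin N),
      g i (WithLp.toLp 2 fun j => if j ∈ s then y j else x j) = g i x := by
    intro s
    induction s using Finset.induction_on with
    | empty => simp
    | insert a s ha ih =>
      rw [← ih]
      by_cases hr : i ∈ receivers g a
      · congr 1
        ext1 j
        by_cases hj : j = a
        · subst hj
          simp [ha, h j hr]
        · simp [hj]
      · by_contra hne
        exact hr ⟨_, _, fun k hk => by simp [hk], hne⟩
  rw [← key Finset.univ]
  simp

/-! ### Decay at a state above the residual level -/

namespace StandingAssumptions

variable {N : ℕ} {n m : Fin N → ℕ}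
  {f : ∀ i, State n → Euc (m i) → Euc (n i)} {g : ∀ i, State n → Euc (m i)}
  {V : ∀ i, Euc (n i) → ℝ≥0} {α₁ α₂ : Fin N → ℝ≥0 → ℝ≥0}
  {mu : Fin N → (Fin N ⊕ Fin N → ℝ≥0) → ℝ≥0} {γ η : Fin N → Fin N → ℝ≥0 → ℝ≥0}
  {α : Fin N → ℝ≥0 → ℝ≥0} {c : Fin N → ℝ≥0}
  {σ : Fin N → ℝ≥0 → ℝ≥0} {φ : Fin N → Fin N → ℝ≥0 → ℝ≥0} {cHat : Fin N → ℝ≥0}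

theorem sigma_class (S : StandingAssumptions f g V α₁ α₂ mu γ η α c σ φ cHat) (i : Fin N) :
    IsClassKInf (σ i) :=
  S.gain.omegaPath.classKInf i

theorem continuous_V (S : StandingAssumptions f g V α₁ α₂ mu γ η α c σ φ cHat) (i : Fin N) :
    Continuous (V i) :=
  NNReal.isEmbedding_coe.continuous_iff.2 (S.iss.differentiable i).continuous

theorem continuous_lyap (S : StandingAssumptions f g V α₁ α₂ mu γ η α c σ φ cHat) :
    Continuous (lyap V σ) :=
  Continuous.finset_sup_apply fun i _ =>
    (S.sigma_class i).isClassKInf_kinv.continuous.comp ((S.continuous_V i).comp (by fun_prop))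

theorem lyap_le_iff (S : StandingAssumptions f g V α₁ α₂ mu γ η α c σ φ cHat) {x : State n}
    {w : ℝ≥0} : lyap V σ x ≤ w ↔ ∀ i, V i (x i) ≤ σ i w := by
  simp [lyap, Finset.sup_le_iff, (S.sigma_class _).kinv_le_iff]

theorem V_le (S : StandingAssumptions f g V α₁ α₂ mu γ η α c σ φ cHat) (x : State n) (i : Fin N) :
    V i (x i) ≤ σ i (lyap V σ x) :=
  S.lyap_le_iff.1 le_rfl i

theorem norm_le_of_lyap_le (S : StandingAssumptions f g V α₁ α₂ mu γ η α c σ φ cHat) {x : State n}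
    {w : ℝ≥0} (h : lyap V σ x ≤ w) :
    ‖x‖₊ ≤ NNReal.sqrt (∑ i, kinv (α₁ i) (σ i w) ^ 2) := by
  rw [PiLp.nnnorm_eq_of_L2]
  refine NNReal.sqrt_le_sqrt.2 (Finset.sum_le_sum fun i _ => ?_)
  gcongr
  exact (S.iss.lower_class i).le_kinv_iff.2 ((S.iss.lower i _).trans (S.lyap_le_iff.1 h i))

theorem isCompact_lyap_le (S : StandingAssumptions f g V α₁ α₂ mu γ η α c σ φ cHat) (w : ℝ≥0) :
    IsCompact {x | lyap V σ x ≤ w} := by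
  refine Metric.isCompact_of_isClosed_isBounded
    (isClosed_le S.continuous_lyap continuous_const) ?_
  refine (Metric.isBounded_closedBall (x := 0)
    (r := (NNReal.sqrt (∑ i, kinv (α₁ i) (σ i w) ^ 2) : ℝ))).subset fun x hx => ?_
  rw [mem_closedBall_zero_iff]
  exact NNReal.coe_le_coe.2 (S.norm_le_of_lyap_le hx)

theorem continuous_etaHat (S : StandingAssumptions f g V α₁ α₂ mu γ η α c σ φ cHat) (j : Fin N) :
    Continuous (etaHat g φ η j) := by
  classical
  refine Continuous.finset_sup_apply fun i hi => ?_
  have hi' : i ∈ receivers g j := by simpa using hi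
  exact (S.receivers_class i j hi').isClassKInf_kinv.continuous.comp
    (S.iss.error_gain_class i j).continuous

theorem etaHat_zero (S : StandingAssumptions f g V α₁ α₂ mu γ η α c σ φ cHat) (j : Fin N) :
    etaHat g φ η j 0 = 0 := by
  classical
  refine le_antisymm (Finset.sup_le fun i hi => ?_) zero_le
  have hi' : i ∈ receivers g j := by simpa using hi
  rw [(S.iss.error_gain_class i j).map_zero,
    (S.receivers_class i j hi').isClassKInf_kinv.map_zero]

theorem eta_le_of_etaHat_le (S : StandingAssumptions f g V α₁ α₂ mu γ η α c σ φ cHat)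
    {i j : Fin N} (hij : i ∈ receivers g j) {r s : ℝ≥0} (h : etaHat g φ η j r ≤ s) :
    η i j r ≤ φ i j s := by
  classical
  rw [← (S.receivers_class i j hij).kinv_le_iff]
  exact (Finset.le_sup (f := fun i => kinv (φ i j) (η i j r)) (by simpa using hij)).trans h

/-- On the active indices the Lyapunov function decays, robustly with respect to the size of
the error. -/
theorem exists_robust_decay (S : StandingAssumptions f g V α₁ α₂ mu γ η α c σ φ cHat)
    {x : State n} (hx : residualLevel σ c cHat < lyap V σ x) :
    ∃ ε : ℝ≥0, 0 < ε ∧ ∀ h : State n,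
      (∀ j, etaHat g φ η j ‖h j - x j‖₊ ≤ lyap V σ x + ε) →
      ∀ i, V i (x i) = σ i (lyap V σ x) →
        fderiv ℝ (fun z => (V i z : ℝ)) (x i) (f i x (g i h)) ≤ -(α i ‖x i‖₊ : ℝ) := by
  classical
  set w := lyap V σ x
  have hw0 : 0 < w := lt_of_le_of_lt zero_le hx
  -- The small-gain inequality at level `w` is strict, so by continuity it survives a small increase
  -- of the error argument.
  have hev : ∀ᶠ ε in 𝓝[>] (0 : ℝ≥0), ∀ i,
      mu i (Sum.elim (fun j => γ i j (σ j w)) fun j => φ i j (w + ε)) < σ i w := by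
    refine eventually_all.2 fun i => ?_
    have hc : Continuous fun ε : ℝ≥0 =>
        mu i (Sum.elim (fun j => γ i j (σ j w)) fun j => φ i j (w + ε)) := by
      refine (S.iss.maf i).continuous.comp (continuous_pi fun k => ?_)
      rcases k with j | j
      · exact continuous_const
      · exact (S.gain.error_class i j).continuous.comp (by fun_prop)
    refine ((hc.tendsto 0).mono_left nhdsWithin_le_nhds).eventually_lt_const ?_
    have := S.gain.smallGain w hw0 i
    simpa [gainMapBar] using this
  obtain ⟨ε, hε, hε0⟩ := (hev.and self_mem_nhdsWithin).exists
  refine ⟨ε, hε0, fun h hh i hi => ?_⟩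
  -- The triggers say nothing about `η i j` when controller `i` does not use block `j`; setting
  -- those error blocks to zero leaves `g i` unchanged and makes their gains vanish.
  let e : State n := WithLp.toLp 2 fun j => if i ∈ receivers g j then h j - x j else 0
  have he : g i (x + e) = g i h := by
    refine eq_of_eq_on_receivers fun j hj => ?_
    simp [e, hj]
  rw [← he]
  refine S.iss.decay i x e (max_le ?_ ?_)
  · rw [hi]
    refine le_trans ((S.iss.maf i).monotone fun k => ?_) (hε i).le
    rcases k with j | j
    · exact (S.iss.gain_class i j).monotone (S.V_le x j)
    · by_cases hj : i ∈ receivers g j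
      · simpa [e, hj] using S.eta_le_of_etaHat_le hj (hh j)
      · simp [e, hj, (S.iss.error_gain_class i j).map_zero]
  · rw [hi, ← (S.sigma_class i).kinv_le_iff]
    refine le_trans ?_ hx.le
    exact (le_max_right _ _).trans
      (Finset.le_sup (f := fun i => max (cHat i) (kinv (σ i) (c i))) (Finset.mem_univ i))

theorem trigger_nonpos_iff {i : Fin N} {z e : Euc (n i)} :
    practicalTrigger g V φ η σ cHat i z e ≤ 0 ↔
      etaHat g φ η i ‖e‖₊ ≤ max (kinv (σ i) (V i z)) (cHat i) := by
  rw [practicalTrigger, sub_nonpos, NNReal.coe_le_coe]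

theorem trigger_neg_iff {i : Fin N} {z e : Euc (n i)} :
    practicalTrigger g V φ η σ cHat i z e < 0 ↔
      etaHat g φ η i ‖e‖₊ < max (kinv (σ i) (V i z)) (cHat i) := by
  rw [practicalTrigger, sub_neg, NNReal.coe_lt_coe]

/-- The triggers are evaluated at the moving state `y`, whereas the decay estimate needs errors
relative to the fixed `x`. Compactness of `K` makes the passage from `y` to `x` uniform in the held
state; half of `ε` pays for it and half for the variation of `lyap V σ`. -/
theorem eventually_etaHat_le (S : StandingAssumptions f g V α₁ α₂ mu γ η α c σ φ cHat)
    {x : State n} (hx : residualLevel σ c cHat < lyap V σ x) {K : Set (State n)}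
    (hK : IsCompact K) {ε : ℝ≥0} (hε : 0 < ε) :
    ∀ᶠ y in 𝓝 x, ∀ h ∈ K, (∀ i, practicalTrigger g V φ η σ cHat i (y i) (h i - y i) ≤ 0) →
      ∀ j, etaHat g φ η j ‖h j - x j‖₊ ≤ lyap V σ x + ε := by
  have h1 : ∀ᶠ y in 𝓝 x, lyap V σ y < lyap V σ x + ε / 2 :=
    (S.continuous_lyap.tendsto x).eventually_lt_const (lt_add_of_pos_right _ (half_pos hε))
  have h2 : ∀ᶠ y in 𝓝 x, ∀ h ∈ K, ∀ j,
      etaHat g φ η j ‖h j - x j‖₊ < etaHat g φ η j ‖h j - y j‖₊ + ε / 2 := by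
    refine hK.eventually_forall_of_forall_eventually fun h _ => eventually_all.2 fun j => ?_
    have hc := S.continuous_etaHat j
    refine (Continuous.tendsto (f := fun p : State n × State n => etaHat g φ η j ‖p.2 j - x j‖₊)
      (by fun_prop) (x, h)).eventually_lt (Continuous.tendsto (f := fun p : State n × State n =>
        etaHat g φ η j ‖p.2 j - p.1 j‖₊ + ε / 2) (by fun_prop) (x, h)) ?_
    exact lt_add_of_pos_right _ (half_pos hε)
  filter_upwards [h1, h2] with y hy1 hy2 h hh htr j
  refine (hy2 h hh j).le.trans ?_
  have h3 : etaHat g φ η j ‖h j - y j‖₊ ≤ lyap V σ x + ε / 2 := by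
    refine (trigger_nonpos_iff.1 (htr j)).trans (max_le ?_ ?_)
    · exact (Finset.le_sup (f := fun i => kinv (σ i) (V i (y i))) (Finset.mem_univ j)).trans hy1.le
    · refine le_add_right (le_trans ?_ hx.le)
      exact (le_max_left _ _).trans
        (Finset.le_sup (f := fun i => max (cHat i) (kinv (σ i) (c i))) (Finset.mem_univ j))
  calc _ ≤ lyap V σ x + ε / 2 + ε / 2 := by gcongr
    _ = _ := by rw [add_assoc, add_halves]

/-- As `g i` need not be continuous, compactness arguments run over a closed ball containing its
values on `K`. -/
theorem exists_input_bound (S : StandingAssumptions f g V α₁ α₂ mu γ η α c σ φ cHat)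
    {K : Set (State n)} (hK : IsCompact K) (i : Fin N) :
    ∃ B : Set (Euc (m i)), IsCompact B ∧ ∀ h ∈ K, g i h ∈ B := by
  obtain ⟨C, hC⟩ := S.boundedOnCompacts i K hK
  exact ⟨Metric.closedBall 0 C, isCompact_closedBall _ _, fun h hh => by simpa using hC h hh⟩

theorem exists_heldField_bound (S : StandingAssumptions f g V α₁ α₂ mu γ η α c σ φ cHat)
    {C K : Set (State n)} (hC : IsCompact C) (hK : IsCompact K) :
    ∃ M : ℝ, 0 ≤ M ∧ ∀ y ∈ C, ∀ h ∈ K, ‖heldField f g y h‖ ≤ M := by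
  have h1 : ∀ i, ∃ M : ℝ, ∀ y ∈ C, ∀ h ∈ K, ‖f i y (g i h)‖ ≤ M := by
    intro i
    obtain ⟨B, hB, hgB⟩ := S.exists_input_bound hK i
    obtain ⟨M, hM⟩ := (hC.prod hB).exists_bound_of_continuousOn
      (S.continuous_field i).continuousOn
    exact ⟨M, fun y hy h hh => hM (y, g i h) ⟨hy, hgB h hh⟩⟩
  choose M hM using h1
  refine ⟨√(∑ i, M i ^ 2), Real.sqrt_nonneg _, fun y hy h hh => ?_⟩
  rw [PiLp.norm_eq_of_L2]
  refine Real.sqrt_le_sqrt (Finset.sum_le_sum fun i _ => ?_)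
  exact pow_le_pow_left₀ (norm_nonneg _) (hM i y hy h hh) 2

/-- The derivative of `V i` stays frozen at `x i`, so neither continuity of the gradient nor of `α
i` is needed. Only the state argument of `f i` moves, uniformly over the compact set of inputs, at
the cost of half the decay `α i ‖x i‖₊`. This decay is positive since an active index has `V i (x i)
> 0`. -/
theorem eventually_decay (S : StandingAssumptions f g V α₁ α₂ mu γ η α c σ φ cHat)
    {x : State n} (hx : residualLevel σ c cHat < lyap V σ x) {K : Set (State n)}
    (hK : IsCompact K) {i : Fin N} (hi : V i (x i) = σ i (lyap V σ x)) :
    ∃ a : ℝ, 0 < a ∧ ∀ᶠ y in 𝓝 x, ∀ h ∈ K,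
      (∀ i, practicalTrigger g V φ η σ cHat i (y i) (h i - y i) ≤ 0) →
        fderiv ℝ (fun z => (V i z : ℝ)) (x i) (f i y (g i h)) ≤ -a := by
  have hw0 : 0 < lyap V σ x := lt_of_le_of_lt zero_le hx
  have hxi : x i ≠ 0 := by
    intro h0
    have h1 := S.iss.upper i (x i)
    rw [h0, nnnorm_zero, (S.iss.upper_class i).map_zero, ← h0, hi] at h1
    exact absurd ((S.sigma_class i).pos hw0) (not_lt.2 h1)
  have ha : 0 < α i ‖x i‖₊ := by
    refine pos_iff_ne_zero.2 fun h0 => hxi ?_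
    simpa using (S.iss.decay_posDef i _).1 h0
  obtain ⟨ε, hε, hdec⟩ := S.exists_robust_decay hx
  obtain ⟨B, hB, hgB⟩ := S.exists_input_bound hK i
  set L := fderiv ℝ (fun z => (V i z : ℝ)) (x i)
  have h1 : ∀ᶠ y in 𝓝 x, ∀ u ∈ B, L (f i y u) < L (f i x u) + α i ‖x i‖₊ / 2 := by
    refine hB.eventually_forall_of_forall_eventually fun u _ => ?_
    have hc := S.continuous_field i
    have hc' : Continuous fun p : State n × Euc (m i) => f i x p.2 :=
      hc.comp (continuous_const.prodMk continuous_snd)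
    refine ((L.continuous.comp hc).tendsto (x, u)).eventually_lt
      (((L.continuous.comp hc').add_const _).tendsto (x, u)) ?_
    exact lt_add_of_pos_right _ (by positivity)
  refine ⟨α i ‖x i‖₊ / 2, by positivity, ?_⟩
  filter_upwards [h1, S.eventually_etaHat_le hx hK hε] with y hy1 hy2 h hh htr
  have h3 := hy1 _ (hgB h hh)
  have h4 := hdec h (hy2 h hh htr) i hi
  linarith

end StandingAssumptions

/-! ### Decrease of the Lyapunov function along untriggered arcs -/

/-- The speed bound holds only inside the ball, so the comparison function has slope `M + 1`: at a
point of contact the arc is still in the ball by `hR`, and there its speed is strictly smaller. -/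
theorem IsUntriggeredArc.norm_sub_le {N : ℕ} {n m : Fin N → ℕ}
    {f : ∀ i, State n → Euc (m i) → Euc (n i)} {g : ∀ i, State n → Euc (m i)}
    {Tr : ∀ i, Euc (n i) → Euc (n i) → ℝ} {K : Set (State n)} {a b : ℝ}
    {y : ℝ → State n} (h : IsUntriggeredArc f g Tr K a b y) {x : State n} {R M ρ : ℝ}
    (hM : ∀ z ∈ Metric.closedBall x R, ∀ h ∈ K, ‖heldField f g z h‖ ≤ M)
    (hM0 : 0 ≤ M) (hy : ‖y a - x‖ ≤ ρ) (hR : ρ + (M + 1) * (b - a) ≤ R) :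
    ∀ s ∈ Icc a b, ‖y s - x‖ ≤ ρ + (M + 1) * (s - a) := by
  choose! z hz htr hder using h.2
  refine image_norm_le_of_norm_deriv_right_lt_deriv_boundary'
    (f := fun s => y s - x) (f' := fun s => heldField f g (y s) (z s))
    (B := fun s => ρ + (M + 1) * (s - a)) (B' := fun _ => M + 1)
    (h.1.sub continuousOn_const) (fun s hs => (hder s hs).sub_const x) (by simpa using hy)
    (by fun_prop) (fun s _ => ?_) fun s hs heq => ?_
  · simpa using ((((hasDerivAt_id s).sub_const a).const_mul (M + 1)).const_add ρ).hasDerivWithinAt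
  · refine (hM _ ?_ _ (hz s hs)).trans_lt (lt_add_one M)
    rw [mem_closedBall_iff_norm, heq]
    refine le_trans ?_ hR
    gcongr
    exact hs.2.le

namespace StandingAssumptions

variable {N : ℕ} {n m : Fin N → ℕ}
  {f : ∀ i, State n → Euc (m i) → Euc (n i)} {g : ∀ i, State n → Euc (m i)}
  {V : ∀ i, Euc (n i) → ℝ≥0} {α₁ α₂ : Fin N → ℝ≥0 → ℝ≥0}
  {mu : Fin N → (Fin N ⊕ Fin N → ℝ≥0) → ℝ≥0} {γ η : Fin N → Fin N → ℝ≥0 → ℝ≥0}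
  {α : Fin N → ℝ≥0 → ℝ≥0} {c : Fin N → ℝ≥0}
  {σ : Fin N → ℝ≥0 → ℝ≥0} {φ : Fin N → Fin N → ℝ≥0 → ℝ≥0} {cHat : Fin N → ℝ≥0}

/-- An inactive index stays below the level by continuity. For an active index the linearization at
`x` drops by `a * τ`, which outweighs both the linearization error and the initial displacement. The
admissible displacement `ρ` scales with `τ`, so `τ` is fixed first; all small `τ` are allowed, so
that finitely many indices can share one. -/
theorem eventually_V_le (S : StandingAssumptions f g V α₁ α₂ mu γ η α c σ φ cHat)
    {x : State n} (hx : residualLevel σ c cHat < lyap V σ x) {K : Set (State n)}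
    (hK : IsCompact K) (i : Fin N) :
    ∀ᶠ τ in 𝓝[>] (0 : ℝ), ∃ ρ : ℝ, 0 < ρ ∧ ∃ v < σ i (lyap V σ x), ∀ (t₀ : ℝ) (y : ℝ → State n),
      IsUntriggeredArc f g (practicalTrigger g V φ η σ cHat) K t₀ (t₀ + τ) y →
        ‖y t₀ - x‖ ≤ ρ → V i (y (t₀ + τ) i) ≤ v := by
  obtain ⟨M, hM0, hM⟩ := S.exists_heldField_bound (isCompact_closedBall x 1) hK
  have hsmall : ∀ r : ℝ, 0 < r → ∀ᶠ τ in 𝓝[>] (0 : ℝ), (M + 1) * τ < r := by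
    intro r hr
    have hc : Continuous fun τ : ℝ => (M + 1) * τ := by fun_prop
    exact ((hc.tendsto 0).mono_left nhdsWithin_le_nhds).eventually_lt_const (by simpa using hr)
  rcases (S.V_le x i).lt_or_eq with hlt | hact
  · obtain ⟨v, hv1, hv2⟩ := exists_between hlt
    have hc : Continuous fun y : State n => V i (y i) := (S.continuous_V i).comp (by fun_prop)
    obtain ⟨r, hr, hball⟩ := Metric.eventually_nhds_iff_ball.1
      ((hc.tendsto x).eventually_lt_const hv1)
    have hr1 : 0 < min r 1 := lt_min hr one_pos
    filter_upwards [hsmall (min r 1 / 2) (by positivity), self_mem_nhdsWithin] with τ hτ hτ0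
    rw [mem_Ioi] at hτ0
    refine ⟨min r 1 / 4, by positivity, v, hv2, fun t₀ y harc hy => (hball _ ?_).le⟩
    have := harc.norm_sub_le hM hM0 hy (by linarith [min_le_right r 1]) (t₀ + τ)
      ⟨by linarith, le_rfl⟩
    rw [mem_ball_iff_norm]
    rw [add_sub_cancel_left] at this
    linarith [min_le_left r 1]
  · obtain ⟨a, ha, hdec⟩ := S.eventually_decay hx hK hact
    set L := fderiv ℝ (fun z => (V i z : ℝ)) (x i)
    have hε : 0 < a / (8 * (M + 1)) := by positivity
    -- With this accuracy the linearization error along a displacement `(M + 1) * τ` is at most `a *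
    -- τ / 8`.
    set ε := a / (8 * (M + 1)) with hεdef
    have hεM : ε * (M + 1) = a / 8 := by rw [hεdef]; field_simp
    have hd : ∀ᶠ y in 𝓝 x, ‖(V i (y i) : ℝ) - V i (x i) - L (y i - x i)‖ ≤ ε * ‖y i - x i‖ := by
      have h1 := ((S.iss.differentiable i (x i)).hasFDerivAt.isLittleO.def hε)
      exact (Continuous.tendsto (f := fun y : State n => y i) (by fun_prop) x).eventually h1
    obtain ⟨r, hr, hball⟩ := Metric.eventually_nhds_iff_ball.1 (hdec.and hd)
    have hr1 : 0 < min r 1 := lt_min hr one_pos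
    have hw0 : 0 < σ i (lyap V σ x) := (S.sigma_class i).pos (lt_of_le_of_lt zero_le hx)
    filter_upwards [hsmall (min r 1 / 2) (by positivity), self_mem_nhdsWithin] with τ hτ hτ0
    rw [mem_Ioi] at hτ0
    have hLn : 0 ≤ ‖L‖ := norm_nonneg _
    -- The second bound on `ρ` limits the effect of the initial displacement to `a * τ / 8`. The net
    -- drop is thus at least `3 * a * τ / 4`, of which `a * τ / 4` is claimed; truncation at zero is
    -- harmless because the level is positive.
    refine ⟨min (min r 1 / 4) (a * τ / (8 * (‖L‖ + ε + 1))), by positivity,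
      ((V i (x i) : ℝ) - a * τ / 4).toNNReal, ?_, fun t₀ y harc hy => ?_⟩
    · rw [← hact] at hw0 ⊢
      have : 0 < a * τ := by positivity
      rw [← NNReal.coe_lt_coe, Real.coe_toNNReal']
      exact max_lt (by linarith) (by exact_mod_cast hw0)
    · have hρ1 := hy.trans (min_le_left _ _)
      have hρ2 := hy.trans (min_le_right _ _)
      have hconf := harc.norm_sub_le hM hM0 hρ1 (by linarith [min_le_right r 1])
      have hconf' := harc.norm_sub_le hM hM0 le_rfl (by linarith [min_le_right r 1])
      have hin : ∀ s ∈ Icc t₀ (t₀ + τ), y s ∈ Metric.ball x r := by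
        intro s hs
        have h1 := hconf s hs
        have h2 : (M + 1) * (s - t₀) ≤ (M + 1) * τ := by
          gcongr
          linarith [hs.2]
        rw [mem_ball_iff_norm]
        linarith [min_le_left r 1]
      choose! z hz htr hder using harc.2
      have hend : t₀ + τ ∈ Icc t₀ (t₀ + τ) := ⟨by linarith, le_rfl⟩
      have hLy : L (y (t₀ + τ) i) ≤ L (y t₀ i) + -a * (t₀ + τ - t₀) := by
        let P : State n →L[ℝ] ℝ := L.comp (PiLp.proj 2 (fun i => Euc (n i)) i)
        refine image_le_of_deriv_right_le_deriv_boundary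
          (f := fun s => P (y s)) (f' := fun s => P (heldField f g (y s) (z s)))
          (B := fun s => L (y t₀ i) + -a * (s - t₀)) (B' := fun _ => -a)
          (P.continuous.comp_continuousOn harc.1)
          (fun s hs => P.hasFDerivAt.comp_hasDerivWithinAt s (hder s hs)) (by simp [P])
          (by fun_prop) (fun s _ => ?_) (fun s hs => ?_) hend
        · simpa using
            ((((hasDerivAt_id s).sub_const t₀).const_mul (-a)).const_add (L (y t₀ i))).hasDerivWithinAt
        · exact (hball _ (hin s (Ico_subset_Icc_self hs))).1 _ (hz s hs) (htr s hs)
      have hV := (hball _ (hin _ hend)).2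
      have h3 := (le_abs_self _).trans ((Real.norm_eq_abs _).symm.le.trans hV)
      have h4 : ‖y (t₀ + τ) i - x i‖ ≤ ‖y (t₀ + τ) - x‖ :=
        PiLp.norm_apply_le (y (t₀ + τ) - x) i
      have h5 : ‖y t₀ i - x i‖ ≤ ‖y t₀ - x‖ := PiLp.norm_apply_le (y t₀ - x) i
      have h6 : L (y t₀ i - x i) ≤ ‖L‖ * ‖y t₀ - x‖ :=
        (le_abs_self _).trans ((L.le_opNorm _).trans (by gcongr))
      have h7 := hconf' _ hend
      have h8 : (‖L‖ + ε + 1) * ‖y t₀ - x‖ ≤ a * τ / 8 := by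
        rw [le_div_iff₀ (by positivity)] at hρ2
        linarith
      have h9 : ε * ‖y (t₀ + τ) i - x i‖ ≤ ε * ‖y t₀ - x‖ + a / 8 * τ := by
        calc _ ≤ ε * (‖y t₀ - x‖ + (M + 1) * (t₀ + τ - t₀)) := by gcongr; exact h4.trans h7
          _ = ε * ‖y t₀ - x‖ + ε * (M + 1) * τ := by ring
          _ = _ := by rw [hεM]
      rw [map_sub] at h3 h6
      refine NNReal.coe_le_coe.1 (le_trans ?_ (Real.le_coe_toNNReal _))
      nlinarith [norm_nonneg (y t₀ - x)]

/-- Above the residual level, arcs that start close to `x` have, after a short time, a value of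
the Lyapunov function that is smaller than its value at `x` by a uniform amount. -/
theorem eventually_lyap_le (S : StandingAssumptions f g V α₁ α₂ mu γ η α c σ φ cHat)
    {x : State n} (hx : residualLevel σ c cHat < lyap V σ x) {K : Set (State n)}
    (hK : IsCompact K) :
    ∀ᶠ τ in 𝓝[>] (0 : ℝ), ∃ ρ : ℝ, 0 < ρ ∧ ∃ w < lyap V σ x, ∀ (t₀ : ℝ) (y : ℝ → State n),
      IsUntriggeredArc f g (practicalTrigger g V φ η σ cHat) K t₀ (t₀ + τ) y →
        ‖y t₀ - x‖ ≤ ρ → lyap V σ (y (t₀ + τ)) ≤ w := by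
  filter_upwards [eventually_all.2 (S.eventually_V_le hx hK)] with τ hτ
  choose ρ hρ v hv h using hτ
  have hρ' : ∀ᶠ r in 𝓝[>] (0 : ℝ), ∀ i, r ≤ ρ i :=
    eventually_all.2 fun i => nhdsWithin_le_nhds (eventually_le_nhds (hρ i))
  obtain ⟨r, hr, hr0⟩ := (hρ'.and self_mem_nhdsWithin).exists
  refine ⟨r, hr0, Finset.univ.sup fun i => kinv (σ i) (v i), ?_, fun t₀ y harc hy => ?_⟩
  · exact (Finset.sup_lt_iff (lt_of_le_of_lt zero_le hx)).2 fun i _ =>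
      (S.sigma_class i).kinv_lt_iff.2 (hv i)
  · exact Finset.sup_mono_fun fun i _ =>
      (S.sigma_class i).kinv_strictMono.monotone (h i t₀ y harc (hy.trans (hr i)))

/-- It suffices to show that `{lyap V σ ≤ w}` cannot be left for each `w` strictly above the bound:
on its boundary the level exceeds the residual level, and the short-time decrease applies for all
small times. -/
theorem lyap_le_along_arc (S : StandingAssumptions f g V α₁ α₂ mu γ η α c σ φ cHat)
    {K : Set (State n)} (hK : IsCompact K) {a b : ℝ} {y : ℝ → State n}
    (harc : IsUntriggeredArc f g (practicalTrigger g V φ η σ cHat) K a b y) {s : ℝ}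
    (hs : s ∈ Icc a b) : lyap V σ (y s) ≤ max (lyap V σ (y a)) (residualLevel σ c cHat) := by
  refine le_of_forall_gt_imp_ge_of_dense fun w hw => ?_
  have hyc : ContinuousOn (fun s => lyap V σ (y s)) (Icc a b) :=
    S.continuous_lyap.comp_continuousOn harc.1
  have hcl : IsClosed ({s | lyap V σ (y s) ≤ w} ∩ Icc a b) := by
    have := hyc.preimage_isClosed_of_isClosed isClosed_Icc (isClosed_Iic (a := w))
    rwa [inter_comm] at this
  refine hcl.Icc_subset_of_forall_mem_nhdsWithin ((le_max_left _ _).trans hw.le) ?_ hs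
  rintro s ⟨hsw, hs⟩
  rcases (show lyap V σ (y s) ≤ w from hsw).lt_or_eq with hlt | heq
  · have h1 : Tendsto (fun s => lyap V σ (y s)) (𝓝[>] s) (𝓝 (lyap V σ (y s))) := by
      refine (hyc s (Ico_subset_Icc_self hs)).mono_left ?_
      rw [← nhdsWithin_Ioc_eq_nhdsGT hs.2]
      exact nhdsWithin_mono _ fun z hz => ⟨hs.1.trans hz.1.le, hz.2⟩
    filter_upwards [h1.eventually_lt_const hlt] with z hz using hz.le
  · have hx : residualLevel σ c cHat < lyap V σ (y s) :=
      heq ▸ lt_of_le_of_lt (le_max_right _ _) hw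
    have h1 : Tendsto (fun z => z - s) (𝓝[>] s) (𝓝[>] 0) := by
      refine tendsto_nhdsWithin_iff.2 ⟨?_, ?_⟩
      · have hc : Continuous fun z : ℝ => z - s := by fun_prop
        simpa using (hc.tendsto s).mono_left (nhdsWithin_le_nhds (s := Ioi s))
      · filter_upwards [self_mem_nhdsWithin] with z hz using sub_pos.2 (mem_Ioi.1 hz)
    filter_upwards [h1.eventually (S.eventually_lyap_le hx hK), Ioc_mem_nhdsGT hs.2] with z hz hzb
    obtain ⟨ρ, hρ, w', hw', h⟩ := hz
    have := h s y (harc.mono subset_rfl hs.1 (by linarith [hzb.2])) (by simpa using hρ.le)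
    rw [add_sub_cancel] at this
    exact this.trans (hw'.le.trans heq.le)

/-- A uniform decrease of the Lyapunov function over short times, on a compact range of levels
above the residual level. -/
theorem exists_uniform_decrease (S : StandingAssumptions f g V α₁ α₂ mu γ η α c σ φ cHat)
    (a : ℝ≥0) {b : ℝ≥0} (hb : residualLevel σ c cHat < b) {K : Set (State n)} (hK : IsCompact K) :
    ∃ δ : ℝ≥0, 0 < δ ∧ ∀ x, b ≤ lyap V σ x → lyap V σ x ≤ a → ∃ τ : ℝ, 0 < τ ∧ τ ≤ 1 ∧
      ∀ (t₀ : ℝ) (y : ℝ → State n), y t₀ = x →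
        IsUntriggeredArc f g (practicalTrigger g V φ η σ cHat) K t₀ (t₀ + τ) y →
          lyap V σ (y (t₀ + τ)) + δ ≤ lyap V σ x := by
  have hC : IsCompact {x | b ≤ lyap V σ x ∧ lyap V σ x ≤ a} :=
    (S.isCompact_lyap_le a).inter_left (isClosed_Ici.preimage S.continuous_lyap)
  have key : ∃ δ : ℝ≥0, 0 < δ ∧ ∀ x ∈ {x | b ≤ lyap V σ x ∧ lyap V σ x ≤ a},
      ∃ τ : ℝ, 0 < τ ∧ τ ≤ 1 ∧ ∀ (t₀ : ℝ) (y : ℝ → State n), y t₀ = x →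
        IsUntriggeredArc f g (practicalTrigger g V φ η σ cHat) K t₀ (t₀ + τ) y →
          lyap V σ (y (t₀ + τ)) + δ ≤ lyap V σ x := by
    -- Only `δ` has to be uniform; the duration `τ` may vary with the starting state, so finite
    -- unions need just a minimum of the `δ`s.
    refine hC.induction_on ⟨1, one_pos, by simp⟩ ?_ ?_ ?_
    · rintro s t hst ⟨δ, hδ, h⟩
      exact ⟨δ, hδ, fun x hx => h x (hst hx)⟩
    · rintro s t ⟨δ, hδ, h⟩ ⟨δ', hδ', h'⟩
      refine ⟨min δ δ', lt_min hδ hδ', fun x hx => ?_⟩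
      rcases hx with hx | hx
      · obtain ⟨τ, h0, h1, h2⟩ := h x hx
        exact ⟨τ, h0, h1, fun t₀ y hy harc =>
          (add_le_add_right (min_le_left _ _) _).trans (h2 t₀ y hy harc)⟩
      · obtain ⟨τ, h0, h1, h2⟩ := h' x hx
        exact ⟨τ, h0, h1, fun t₀ y hy harc =>
          (add_le_add_right (min_le_right _ _) _).trans (h2 t₀ y hy harc)⟩
    · intro x hx
      have hxl := hb.trans_le hx.1
      obtain ⟨τ, ⟨ρ, hρ, w, hw, h⟩, hτ⟩ :=
        ((S.eventually_lyap_le hxl hK).and (Ioc_mem_nhdsGT one_pos)).exists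
      obtain ⟨w', hw1, hw2⟩ := exists_between hw
      -- Arcs from this neighbourhood start above `w'` and end at or below `w`, hence lose at least
      -- `w' - w`.
      refine ⟨Metric.closedBall x ρ ∩ {z | w' < lyap V σ z}, mem_nhdsWithin_of_mem_nhds
        (inter_mem (Metric.closedBall_mem_nhds x hρ)
          ((S.continuous_lyap.tendsto x).eventually_const_lt hw2)),
        w' - w, tsub_pos_of_lt hw1, fun z hz => ⟨τ, hτ.1, hτ.2, fun t₀ y hy harc => ?_⟩⟩
      have h1 := h t₀ y harc (by rw [hy]; exact mem_closedBall_iff_norm.1 hz.1)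
      calc _ ≤ w + (w' - w) := by gcongr
        _ = w' := add_tsub_cancel_of_le hw1.le
        _ ≤ _ := hz.2.le
  obtain ⟨δ, hδ, h⟩ := key
  exact ⟨δ, hδ, fun x h1 h2 => h x ⟨h1, h2⟩⟩

/-- Uniform attraction of the sublevel sets above the residual level. -/
theorem exists_uniform_time (S : StandingAssumptions f g V α₁ α₂ mu γ η α c σ φ cHat)
    (a : ℝ≥0) {b : ℝ≥0} (hb : residualLevel σ c cHat < b) {K : Set (State n)} (hK : IsCompact K) :
    ∃ T : ℝ≥0, ∀ y : ℝ → State n,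
      (∀ t : ℝ, IsUntriggeredArc f g (practicalTrigger g V φ η σ cHat) K 0 t y) →
        lyap V σ (y 0) ≤ a → ∀ t : ℝ, T ≤ t → lyap V σ (y t) ≤ b := by
  obtain ⟨δ, hδ, hdec⟩ := S.exists_uniform_decrease (max a (residualLevel σ c cHat)) hb hK
  obtain ⟨k, hk⟩ := exists_lt_nsmul hδ a
  refine ⟨k, fun y harc hy t ht => ?_⟩
  have hbound : ∀ {s t : ℝ}, 0 ≤ s → s ≤ t → lyap V σ (y s) ≤ b → lyap V σ (y t) ≤ b := by
    intro s t hs hst h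
    refine (S.lyap_le_along_arc hK ((harc t).mono subset_rfl hs le_rfl) ⟨hst, le_rfl⟩).trans ?_
    exact max_le h hb.le
  -- Each loss of `δ` takes at most unit time. Since `k • δ > a`, the level `b` is reached by time
  -- `k`, and `hbound` keeps the arc below it.
  have hstep : ∀ j : ℕ, ∃ s : ℝ, 0 ≤ s ∧ s ≤ j ∧
      (lyap V σ (y s) ≤ b ∨ lyap V σ (y s) + j • δ ≤ a) := by
    intro j
    induction j with
    | zero => exact ⟨0, le_rfl, by simp, Or.inr (by simpa using hy)⟩
    | succ j ih =>
      obtain ⟨s, hs0, hsj, hs⟩ := ih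
      by_cases h : lyap V σ (y s) ≤ b
      · exact ⟨s, hs0, hsj.trans (by simp), Or.inl h⟩
      · have h1 := hs.resolve_left h
        obtain ⟨τ, hτ0, hτ1, h2⟩ := hdec (y s) (not_le.1 h).le
          (le_trans (le_trans le_self_add h1) (le_max_left _ _))
        refine ⟨s + τ, by linarith, by push_cast; linarith, Or.inr ?_⟩
        have h3 := h2 s y rfl ((harc (s + τ)).mono subset_rfl hs0 le_rfl)
        rw [succ_nsmul', ← add_assoc]
        exact (add_le_add_left h3 _).trans h1
  obtain ⟨s, hs0, hsk, h | h⟩ := hstep k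
  · exact hbound hs0 (hsk.trans (by simpa using ht)) h
  · exact absurd (le_trans le_add_self h) (not_le.2 hk)

end StandingAssumptions

/-! ### Event times and derivatives of solutions -/

theorem hasDerivAt_state_iff {N : ℕ} {n : Fin N → ℕ} {x : ℝ → State n} {v : State n} {s : ℝ} :
    HasDerivAt x v s ↔ ∀ i, HasDerivAt (fun τ => x τ i) (v i) s := by
  let e := PiLp.continuousLinearEquiv 2 ℝ fun i => Euc (n i)
  refine ⟨fun h i => ?_, fun h => ?_⟩
  · exact (PiLp.proj 2 (𝕜 := ℝ) (fun i => Euc (n i)) i).hasFDerivAt.comp_hasDerivAt s h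
  · have h1 : HasDerivAt (fun τ => e (x τ)) (e v) s := hasDerivAt_pi.2 h
    have h2 := e.symm.toContinuousLinearMap.hasFDerivAt.comp_hasDerivAt s h1
    simpa [Function.comp_def] using h2

theorem continuous_heldField {N : ℕ} {n m : Fin N → ℕ}
    {f : ∀ i, State n → Euc (m i) → Euc (n i)} (g : ∀ i, State n → Euc (m i))
    (hf : ∀ i, Continuous fun p : State n × Euc (m i) => f i p.1 p.2) (h : State n) :
    Continuous fun x => heldField f g x h :=
  (PiLp.continuous_toLp 2 _).comp
    (continuous_pi fun i => (hf i).comp (continuous_id.prodMk continuous_const))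

/-- The differential equation is imposed only strictly between events; the limit of the derivatives
supplies the right derivative at an event time, with the new held state. -/
theorem hasDerivWithinAt_Ici_of_hasDerivAt_Ioo {E : Type*} [NormedAddCommGroup E] [NormedSpace ℝ E]
    {x : ℝ → E} {F : E → E} (hF : Continuous F) {a b : ℝ} (hab : a < b)
    (hx : Tendsto x (𝓝[>] a) (𝓝 (x a))) (hder : ∀ s ∈ Ioo a b, HasDerivAt x (F (x s)) s) :
    HasDerivWithinAt x (F (x a)) (Ici a) a := by
  refine hasDerivWithinAt_Ici_of_tendsto_deriv (s := Ioo a b)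
    (fun s hs => (hder s hs).differentiableAt.differentiableWithinAt)
    (hx.mono_left (nhdsWithin_mono _ Ioo_subset_Ioi_self)) (Ioo_mem_nhdsGT hab) ?_
  refine ((hF.tendsto (x a)).comp hx).congr' ?_
  filter_upwards [Ioo_mem_nhdsGT hab] with s hs using (hder s hs).deriv.symm

theorem exists_real_gt_of_coe_lt {s : ℝ} {T : EReal} (hs : (s : EReal) < T) :
    ∃ b : ℝ, s < b ∧ (b : EReal) < T := by
  obtain ⟨b, h1, h2⟩ := EReal.lt_iff_exists_real_btwn.1 hs
  exact ⟨b, EReal.coe_lt_coe_iff.1 h1, h2⟩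

theorem nhdsGT_le_nhdsWithin_domain {s : ℝ} {T : EReal} (hs0 : 0 ≤ s) (hs : (s : EReal) < T) :
    𝓝[>] s ≤ 𝓝[{s : ℝ | 0 ≤ s ∧ (s : EReal) < T}] s := by
  obtain ⟨b, h1, h2⟩ := exists_real_gt_of_coe_lt hs
  rw [← nhdsWithin_Ioo_eq_nhdsGT h1]
  exact nhdsWithin_mono _ fun z hz =>
    ⟨hs0.trans hz.1.le, (EReal.coe_lt_coe_iff.2 hz.2).trans h2⟩

/-- The set of times in `(a, T)` at which some triggering condition holds, for the held
state `h`. -/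
def eventSet {N : ℕ} {n : Fin N → ℕ} (Tr : ∀ i, Euc (n i) → Euc (n i) → ℝ) (x : ℝ → State n)
    (a T : EReal) (h : State n) : Set ℝ :=
  {s : ℝ | a < s ∧ (s : EReal) < T ∧ ∃ i, 0 ≤ Tr i (x s i) (h i - x s i)}

theorem eventually_trigger_neg {N : ℕ} {n : Fin N → ℕ} {Tr : ∀ i, Euc (n i) → Euc (n i) → ℝ}
    (hTc : ∀ i, Continuous fun p : Euc (n i) × Euc (n i) => Tr i p.1 p.2) {x : ℝ → State n}
    {l : Filter ℝ} {s : ℝ} (hx : Tendsto x l (𝓝 (x s))) {h : State n}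
    (hneg : ∀ i, Tr i (x s i) (h i - x s i) < 0) :
    ∀ᶠ s' in l, ∀ i, Tr i (x s' i) (h i - x s' i) < 0 := by
  refine eventually_all.2 fun i => ?_
  have hc : Continuous fun z : State n => Tr i (z i) (h i - z i) :=
    (hTc i).comp (by fun_prop : Continuous fun z : State n => (z i, h i - z i))
  exact ((hc.tendsto (x s)).comp hx).eventually_lt_const (hneg i)

/-- If no triggering condition holds on `(a, s]`, then there is a gap before the next event. -/
theorem lt_sInf_eventSet {N : ℕ} {n : Fin N → ℕ} {Tr : ∀ i, Euc (n i) → Euc (n i) → ℝ}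
    (hTc : ∀ i, Continuous fun p : Euc (n i) × Euc (n i) => Tr i p.1 p.2) {x : ℝ → State n}
    {a T : EReal} {s : ℝ} (hx : Tendsto x (𝓝[>] s) (𝓝 (x s))) {h : State n}
    (hneg : ∀ i, Tr i (x s i) (h i - x s i) < 0)
    (hlt : ∀ s' : ℝ, a < s' → s' < s → s' ∉ eventSet Tr x a T h) :
    (s : EReal) < sInf ((fun s : ℝ => (s : EReal)) '' eventSet Tr x a T h) := by
  obtain ⟨b, hb, hsub⟩ := mem_nhdsGT_iff_exists_Ioo_subset.1 (eventually_trigger_neg hTc hx hneg)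
  refine (EReal.coe_lt_coe_iff.2 hb).trans_le (le_sInf ?_)
  rintro _ ⟨s', hs', rfl⟩
  rw [EReal.coe_le_coe_iff]
  by_contra hcon
  rw [not_le] at hcon
  obtain ⟨i, hi⟩ := hs'.2.2
  rcases lt_trichotomy s' s with h1 | rfl | h1
  · exact hlt s' hs'.1 h1 hs'
  · exact (hneg i).not_ge hi
  · exact (hsub ⟨h1, hcon⟩ i).not_ge hi

namespace IsEventTriggeredSolution

variable {N : ℕ} {n m : Fin N → ℕ}
  {f : ∀ i, State n → Euc (m i) → Euc (n i)} {g : ∀ i, State n → Euc (m i)}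
  {Tr : ∀ i, Euc (n i) → Euc (n i) → ℝ} {x₀ : State n} {T : EReal}
  {x : ℝ → State n} {t : ℕ → EReal} {xh : ℕ → State n}

theorem time_succ' (h : IsEventTriggeredSolution f g Tr x₀ T x t xh) (k : ℕ) :
    t (k + 1) = sInf ((fun s : ℝ => (s : EReal)) '' eventSet Tr x (t k) T (xh k)) :=
  h.time_succ k

theorem time_monotone (h : IsEventTriggeredSolution f g Tr x₀ T x t xh) : Monotone t := by
  refine monotone_nat_of_le_succ fun k => ?_
  rw [h.time_succ' k]
  refine le_sInf ?_
  rintro _ ⟨s, hs, rfl⟩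
  exact hs.1.le

theorem time_nonneg (h : IsEventTriggeredSolution f g Tr x₀ T x t xh) (k : ℕ) : 0 ≤ t k :=
  h.time_zero.symm.le.trans (h.time_monotone (Nat.zero_le k))

theorem time_lt (h : IsEventTriggeredSolution f g Tr x₀ T x t xh) {k : ℕ} (hk : t k ≠ ⊤) :
    t k < T := by
  cases k with
  | zero => rw [h.time_zero]; exact h.pos
  | succ k =>
    rw [h.time_succ' k] at hk ⊢
    obtain ⟨s, hs⟩ : (eventSet Tr x (t k) T (xh k)).Nonempty := by
      by_contra hne
      rw [not_nonempty_iff_eq_empty] at hne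
      simp [hne] at hk
    exact (sInf_le (mem_image_of_mem _ hs)).trans_lt hs.2.1

theorem exists_real_time (h : IsEventTriggeredSolution f g Tr x₀ T x t xh) {k : ℕ}
    (hk : t k ≠ ⊤) : ∃ s : ℝ, t k = s ∧ 0 ≤ s ∧ (s : EReal) < T := by
  have h0 := h.time_nonneg k
  lift t k to ℝ using ⟨hk, (EReal.bot_lt_zero.trans_le h0).ne'⟩ with s hs
  exact ⟨s, rfl, EReal.coe_nonneg.1 h0, hs ▸ h.time_lt (hs ▸ hk)⟩

theorem tendsto_nhdsGT (h : IsEventTriggeredSolution f g Tr x₀ T x t xh) {s : ℝ} (hs0 : 0 ≤ s)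
    (hs : (s : EReal) < T) : Tendsto x (𝓝[>] s) (𝓝 (x s)) :=
  (h.continuousOn s ⟨hs0, hs⟩).mono_left (nhdsGT_le_nhdsWithin_domain hs0 hs)

/-- A system that resets has zero error, and one that does not reset was below its threshold. -/
theorem trigger_neg_of_time_eq (h : IsEventTriggeredSolution f g Tr x₀ T x t xh)
    (hT0 : ∀ i z, Tr i z 0 < 0) {k : ℕ} {s : ℝ} (hk : t k = s) (i : Fin N) :
    Tr i (x s i) (xh k i - x s i) < 0 := by
  cases k with
  | zero =>
    have hs : s = 0 := by
      have := h.time_zero.symm.trans hk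
      exact_mod_cast this.symm
    rw [hs, h.init, h.held_zero, sub_self]
    exact hT0 i _
  | succ k =>
    by_cases hc : 0 ≤ Tr i (x s i) (xh k i - x s i)
    · rw [(h.held_succ k s hk i).1 hc, sub_self]
      exact hT0 i _
    · rw [(h.held_succ k s hk i).2 hc]
      exact not_le.1 hc

theorem trigger_neg (h : IsEventTriggeredSolution f g Tr x₀ T x t xh)
    (hT0 : ∀ i z, Tr i z 0 < 0) {k : ℕ} {s : ℝ} (hk : t k ≤ s) (hk' : (s : EReal) < t (k + 1))
    (hs : (s : EReal) < T) (i : Fin N) : Tr i (x s i) (xh k i - x s i) < 0 := by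
  rcases hk.eq_or_lt with heq | hlt
  · exact h.trigger_neg_of_time_eq hT0 heq i
  · by_contra hcon
    rw [h.time_succ' k] at hk'
    exact hk'.not_ge (sInf_le ⟨s, ⟨hlt, hs, i, not_lt.1 hcon⟩, rfl⟩)

/-- The infimum defining an event time is attained: if all triggers were negative there, right
continuity would leave a gap before the next event. -/
theorem exists_trigger_nonneg (h : IsEventTriggeredSolution f g Tr x₀ T x t xh)
    (hTc : ∀ i, Continuous fun p : Euc (n i) × Euc (n i) => Tr i p.1 p.2) {k : ℕ} {s : ℝ}
    (hk : t (k + 1) = s) : ∃ i, 0 ≤ Tr i (x s i) (xh k i - x s i) := by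
  by_contra! hcon
  have hne : t (k + 1) ≠ ⊤ := by rw [hk]; exact EReal.coe_ne_top s
  have hs0 : 0 ≤ s := by
    have := h.time_nonneg (k + 1)
    rw [hk] at this
    exact_mod_cast this
  have hsT := h.time_lt hne
  rw [hk] at hsT
  refine (lt_sInf_eventSet hTc (h.tendsto_nhdsGT hs0 hsT) hcon (a := t k) (T := T) ?_).ne' ?_
  · intro s' _ hs' hmem
    have h1 : t (k + 1) ≤ s' := by
      rw [h.time_succ' k]
      exact sInf_le ⟨s', hmem, rfl⟩
    rw [hk, EReal.coe_le_coe_iff] at h1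
    exact h1.not_gt hs'
  · rw [← h.time_succ' k, hk]

theorem exists_interval (h : IsEventTriggeredSolution f g Tr x₀ T x t xh) {s : ℝ} (hs0 : 0 ≤ s)
    (hs : (s : EReal) < T) : ∃ k, t k ≤ s ∧ (s : EReal) < t (k + 1) := by
  classical
  have hex := h.covered s hs
  have hfind := Nat.find_spec hex
  have hmin : ∀ j, j < Nat.find hex → ¬ (s : EReal) < t j := fun j hj => Nat.find_min hex hj
  generalize Nat.find hex = k at hfind hmin
  cases k with
  | zero =>
    rw [h.time_zero] at hfind
    exact absurd hfind (not_lt.2 (EReal.coe_nonneg.2 hs0))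
  | succ k => exact ⟨k, not_lt.1 (hmin k k.lt_succ_self), hfind⟩

theorem hasDerivWithinAt (h : IsEventTriggeredSolution f g Tr x₀ T x t xh)
    (hf : ∀ i, Continuous fun p : State n × Euc (m i) => f i p.1 p.2) {k : ℕ} {s : ℝ}
    (hs0 : 0 ≤ s) (hs : (s : EReal) < T) (hk : t k ≤ s) (hk' : (s : EReal) < t (k + 1)) :
    HasDerivWithinAt x (heldField f g (x s) (xh k)) (Ici s) s := by
  obtain ⟨b, hb, hbT⟩ := exists_real_gt_of_coe_lt (lt_min hs hk')
  have hder : ∀ s' ∈ Ioo s b, HasDerivAt x (heldField f g (x s') (xh k)) s' := by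
    intro s' hs'
    have h1 : (s' : EReal) < min T (t (k + 1)) := (EReal.coe_lt_coe_iff.2 hs'.2).trans hbT
    exact hasDerivAt_state_iff.2 (h.ode k s' (hk.trans_lt (EReal.coe_lt_coe_iff.2 hs'.1))
      (h1.trans_le (min_le_right _ _)) (h1.trans_le (min_le_left _ _)))
  exact hasDerivWithinAt_Ici_of_hasDerivAt_Ioo (continuous_heldField g hf (xh k)) hb
    (h.tendsto_nhdsGT hs0 hs) hder

theorem isUntriggeredArc (h : IsEventTriggeredSolution f g Tr x₀ T x t xh)
    (hf : ∀ i, Continuous fun p : State n × Euc (m i) => f i p.1 p.2)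
    (hT0 : ∀ i z, Tr i z 0 < 0) {b : ℝ} (hb : (b : EReal) < T) {K : Set (State n)}
    (hK : ∀ k, t k ≤ b → xh k ∈ K) : IsUntriggeredArc f g Tr K 0 b x := by
  refine ⟨h.continuousOn.mono fun s hs =>
    ⟨hs.1, (EReal.coe_le_coe_iff.2 hs.2).trans_lt hb⟩, fun s hs => ?_⟩
  have hsb : (s : EReal) < b := EReal.coe_lt_coe_iff.2 hs.2
  have hsT := hsb.trans hb
  obtain ⟨k, hk, hk'⟩ := h.exists_interval hs.1 hsT
  exact ⟨xh k, hK k (hk.trans hsb.le), fun i => (h.trigger_neg hT0 hk hk' hsT i).le,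
    h.hasDerivWithinAt hf hs.1 hsT hk hk'⟩

theorem exists_held_eq (h : IsEventTriggeredSolution f g Tr x₀ T x t xh) {k : ℕ} (hk : t k ≠ ⊤)
    (i : Fin N) : ∃ s : ℝ, 0 ≤ s ∧ (s : EReal) < T ∧ xh k i = x s i := by
  induction k with
  | zero => exact ⟨0, le_rfl, h.pos, by rw [h.init, h.held_zero]⟩
  | succ k ih =>
    obtain ⟨s, hs, hs0, hsT⟩ := h.exists_real_time hk
    by_cases hc : 0 ≤ Tr i (x s i) (xh k i - x s i)
    · exact ⟨s, hs0, hsT, (h.held_succ k s hs i).1 hc⟩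
    · rw [(h.held_succ k s hs i).2 hc]
      exact ih fun htop => hk (top_le_iff.1 (htop.symm.le.trans (h.time_monotone k.le_succ)))

/-- Boundedness of the velocity and a lower bound for the errors at which systems are triggered
exclude accumulation points of the event times. -/
theorem exists_time_gt (h : IsEventTriggeredSolution f g Tr x₀ T x t xh)
    (hTc : ∀ i, Continuous fun p : Euc (n i) × Euc (n i) => Tr i p.1 p.2) {ρ : ℝ} (hρ : 0 < ρ)
    (hTρ : ∀ i z e, 0 ≤ Tr i z e → ρ ≤ ‖e‖) {M : ℝ} (hM0 : 0 ≤ M)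
    (hM : ∀ a b : ℝ, 0 ≤ a → a ≤ b → (b : EReal) < T → ‖x b - x a‖ ≤ M * (b - a)) (S : ℝ) :
    ∃ k, (S : EReal) < t k := by
  classical
  by_contra! hcon
  have hne : ∀ k, t k ≠ ⊤ := fun k => ((hcon k).trans_lt (EReal.coe_lt_top S)).ne
  choose τ hτ hτ0 hτT using fun k => h.exists_real_time (hne k)
  have hmono : Monotone τ := fun j k hjk => by
    have := h.time_monotone hjk
    rwa [hτ, hτ, EReal.coe_le_coe_iff] at this
  have hbdd : BddAbove (range τ) := by
    refine ⟨S, ?_⟩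
    rintro _ ⟨k, rfl⟩
    have := hcon k
    rwa [hτ, EReal.coe_le_coe_iff] at this
  -- Bounded event times converge, so from index `K` on they all lie within `ρ / (M + 1)` of `τ K`.
  obtain ⟨K, hK⟩ := Metric.cauchySeq_iff'.1 (tendsto_atTop_ciSup hmono hbdd).cauchySeq
    (ρ / (M + 1)) (by positivity)
  -- `A` collects systems that have reset since `τ K`. Such a system cannot trigger again, as it
  -- would have to move by `ρ` in a time shorter than `ρ / (M + 1)`. Every event therefore adds a
  -- new system, and `N + 1` events are too many.
  have key : ∀ k : ℕ, ∃ A : Finset (Fin N), A.card = k ∧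
      ∀ i ∈ A, ∃ s : ℝ, τ K ≤ s ∧ s ≤ τ (K + k) ∧ xh (K + k) i = x s i := by
    intro k
    induction k with
    | zero => exact ⟨∅, rfl, by simp⟩
    | succ k ih =>
      obtain ⟨A, hA, hAx⟩ := ih
      obtain ⟨i, hi⟩ := h.exists_trigger_nonneg hTc (hτ (K + k + 1))
      have hi' := hTρ i _ _ hi
      have hle : τ (K + k) ≤ τ (K + k + 1) := hmono (Nat.le_succ _)
      have hiA : i ∉ A := by
        intro hiA
        obtain ⟨s, h1, h2, h3⟩ := hAx i hiA
        rw [h3] at hi'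
        have h4 := hM s (τ (K + k + 1)) ((hτ0 K).trans h1) (h2.trans hle) (hτT _)
        have h5 : ‖x s i - x (τ (K + k + 1)) i‖ ≤ ‖x s - x (τ (K + k + 1))‖ :=
          PiLp.norm_apply_le (x s - x (τ (K + k + 1))) i
        rw [norm_sub_rev] at h4
        have h6 := hK (K + k + 1) (by omega)
        rw [Real.dist_eq, abs_of_nonneg (sub_nonneg.2 (hmono (by omega))),
          lt_div_iff₀ (by positivity)] at h6
        have h7 : M * (τ (K + k + 1) - s) ≤ M * (τ (K + k + 1) - τ K) := by gcongr
        have h8 : τ K ≤ τ (K + k + 1) := hmono (by omega)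
        linarith
      refine ⟨insert i A, by rw [Finset.card_insert_of_notMem hiA, hA], fun j hj => ?_⟩
      by_cases hc : 0 ≤ Tr j (x (τ (K + k + 1)) j) (xh (K + k) j - x (τ (K + k + 1)) j)
      · exact ⟨τ (K + k + 1), hmono (by omega), le_rfl,
          (h.held_succ (K + k) _ (hτ (K + k + 1)) j).1 hc⟩
      · have hjA : j ∈ A := by
          rcases Finset.mem_insert.1 hj with rfl | hjA
          · exact absurd hi hc
          · exact hjA
        obtain ⟨s, h1, h2, h3⟩ := hAx j hjA
        exact ⟨s, h1, h2.trans hle,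
          ((h.held_succ (K + k) _ (hτ (K + k + 1)) j).2 hc).trans h3⟩
  obtain ⟨A, hA, -⟩ := key (N + 1)
  have := A.card_le_univ
  simp only [Fintype.card_fin] at this
  omega

theorem not_isZeno (h : IsEventTriggeredSolution f g Tr x₀ T x t xh)
    (hgt : ∀ S : ℝ, ∃ k, (S : EReal) < t k) : ¬ IsZeno t := by
  rintro ⟨s, hs⟩
  obtain ⟨k, hk⟩ := hgt s
  exact hk.not_ge (h.time_monotone.ge_of_tendsto hs k)

end IsEventTriggeredSolution

/-! ### A priori bounds on solutions and exclusion of Zeno behaviour -/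

namespace StandingAssumptions

variable {N : ℕ} {n m : Fin N → ℕ}
  {f : ∀ i, State n → Euc (m i) → Euc (n i)} {g : ∀ i, State n → Euc (m i)}
  {V : ∀ i, Euc (n i) → ℝ≥0} {α₁ α₂ : Fin N → ℝ≥0 → ℝ≥0}
  {mu : Fin N → (Fin N ⊕ Fin N → ℝ≥0) → ℝ≥0} {γ η : Fin N → Fin N → ℝ≥0 → ℝ≥0}
  {α : Fin N → ℝ≥0 → ℝ≥0} {c : Fin N → ℝ≥0}
  {σ : Fin N → ℝ≥0 → ℝ≥0} {φ : Fin N → Fin N → ℝ≥0 → ℝ≥0} {cHat : Fin N → ℝ≥0}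
  {x₀ : State n} {T : EReal} {x : ℝ → State n} {t : ℕ → EReal} {xh : ℕ → State n}

theorem continuous_trigger (S : StandingAssumptions f g V α₁ α₂ mu γ η α c σ φ cHat) (i : Fin N) :
    Continuous fun p : Euc (n i) × Euc (n i) =>
      practicalTrigger g V φ η σ cHat i p.1 p.2 := by
  have h1 := S.continuous_etaHat i
  have h2 := (S.sigma_class i).isClassKInf_kinv.continuous
  have h3 := S.continuous_V i
  unfold practicalTrigger
  fun_prop

theorem trigger_zero_neg (S : StandingAssumptions f g V α₁ α₂ mu γ η α c σ φ cHat) (i : Fin N)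
    (z : Euc (n i)) : practicalTrigger g V φ η σ cHat i z 0 < 0 := by
  rw [trigger_neg_iff, nnnorm_zero, S.etaHat_zero]
  exact lt_max_of_lt_right (S.cHat_pos i)

/-- `etaHat` is continuous and vanishes at zero, so small errors stay below the positive constants
`cHat i`, whatever the state. -/
theorem exists_le_norm_of_trigger (S : StandingAssumptions f g V α₁ α₂ mu γ η α c σ φ cHat) :
    ∃ ρ : ℝ, 0 < ρ ∧ ∀ i z e, 0 ≤ practicalTrigger g V φ η σ cHat i z e → ρ ≤ ‖e‖ := by
  have hev : ∀ᶠ r in 𝓝 (0 : ℝ≥0), ∀ i, etaHat g φ η i r < cHat i := by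
    refine eventually_all.2 fun i => ((S.continuous_etaHat i).tendsto 0).eventually_lt_const ?_
    rw [S.etaHat_zero]
    exact S.cHat_pos i
  obtain ⟨ρ, hρ, hball⟩ := Metric.eventually_nhds_iff.1 hev
  refine ⟨ρ, hρ, fun i z e htr => ?_⟩
  by_contra hcon
  refine htr.not_gt (trigger_neg_iff.2 (lt_max_of_lt_right (hball (y := ‖e‖₊) ?_ i)))
  rw [NNReal.dist_eq]
  simpa using not_le.1 hcon

theorem lyap_le_along_solution (S : StandingAssumptions f g V α₁ α₂ mu γ η α c σ φ cHat)
    (h : IsEventTriggeredSolution f g (practicalTrigger g V φ η σ cHat) x₀ T x t xh) {s : ℝ}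
    (hs0 : 0 ≤ s) (hs : (s : EReal) < T) :
    lyap V σ (x s) ≤ max (lyap V σ x₀) (residualLevel σ c cHat) := by
  obtain ⟨k, -, hk⟩ := h.exists_interval hs0 hs
  -- No bound on the held states is known yet; up to time `s` there are only finitely many, which is
  -- compact enough.
  have harc := h.isUntriggeredArc S.continuous_field S.trigger_zero_neg hs
    (K := xh '' (Finset.range (k + 1) : Set ℕ)) fun j hj => by
      refine mem_image_of_mem _ ?_
      rw [Finset.coe_range, mem_Iio]
      exact h.time_monotone.reflect_lt (hj.trans_lt hk)
  rw [← h.init]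
  exact S.lyap_le_along_arc ((Finset.finite_toSet _).image _).isCompact harc ⟨hs0, le_rfl⟩

/-- Blocks of a held state may stem from different times. As `lyap V σ` is a maximum over blocks,
its sublevel sets are products, and mixing blocks stays inside. -/
theorem lyap_held_le (S : StandingAssumptions f g V α₁ α₂ mu γ η α c σ φ cHat)
    (h : IsEventTriggeredSolution f g (practicalTrigger g V φ η σ cHat) x₀ T x t xh) {k : ℕ}
    (hk : t k ≠ ⊤) : lyap V σ (xh k) ≤ max (lyap V σ x₀) (residualLevel σ c cHat) := by
  refine S.lyap_le_iff.2 fun i => ?_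
  obtain ⟨s, hs0, hs, heq⟩ := h.exists_held_eq hk i
  rw [heq]
  exact S.lyap_le_iff.1 (S.lyap_le_along_solution h hs0 hs) i

theorem isUntriggeredArc_solution (S : StandingAssumptions f g V α₁ α₂ mu γ η α c σ φ cHat)
    (h : IsEventTriggeredSolution f g (practicalTrigger g V φ η σ cHat) x₀ T x t xh) {w : ℝ≥0}
    (hw : max (lyap V σ x₀) (residualLevel σ c cHat) ≤ w) {b : ℝ} (hb : (b : EReal) < T) :
    IsUntriggeredArc f g (practicalTrigger g V φ η σ cHat) {z | lyap V σ z ≤ w} 0 b x :=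
  h.isUntriggeredArc S.continuous_field S.trigger_zero_neg hb fun _ hk =>
    (S.lyap_held_le h (hk.trans_lt (EReal.coe_lt_top b)).ne).trans hw

theorem exists_lipschitz (S : StandingAssumptions f g V α₁ α₂ mu γ η α c σ φ cHat)
    (h : IsEventTriggeredSolution f g (practicalTrigger g V φ η σ cHat) x₀ T x t xh) :
    ∃ M : ℝ, 0 ≤ M ∧ ∀ a b : ℝ, 0 ≤ a → a ≤ b → (b : EReal) < T →
      ‖x b - x a‖ ≤ M * (b - a) := by
  have hC := S.isCompact_lyap_le (max (lyap V σ x₀) (residualLevel σ c cHat))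
  obtain ⟨M, hM0, hM⟩ := S.exists_heldField_bound hC hC
  refine ⟨M, hM0, fun a b ha hab hb => ?_⟩
  have harc := (S.isUntriggeredArc_solution h le_rfl hb).mono subset_rfl ha le_rfl
  choose! z hz htr hder using harc.2
  refine norm_image_sub_le_of_norm_deriv_right_le_segment harc.1 hder (fun s hs => ?_) b
    ⟨hab, le_rfl⟩
  exact hM _ (S.lyap_le_along_solution h (ha.trans hs.1)
    ((EReal.coe_lt_coe_iff.2 hs.2).trans hb)) _ (hz s hs)

theorem exists_time_gt (S : StandingAssumptions f g V α₁ α₂ mu γ η α c σ φ cHat)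
    (h : IsEventTriggeredSolution f g (practicalTrigger g V φ η σ cHat) x₀ T x t xh) (r : ℝ) :
    ∃ k, (r : EReal) < t k := by
  obtain ⟨ρ, hρ, hTρ⟩ := S.exists_le_norm_of_trigger
  obtain ⟨M, hM0, hM⟩ := S.exists_lipschitz h
  exact h.exists_time_gt S.continuous_trigger hρ hTρ hM0 hM r

theorem exists_last_event (S : StandingAssumptions f g V α₁ α₂ mu γ η α c σ φ cHat) {T : ℝ}
    (h : IsEventTriggeredSolution f g (practicalTrigger g V φ η σ cHat) x₀ T x t xh) :
    ∃ k, t k ≠ ⊤ ∧ t (k + 1) = ⊤ := by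
  classical
  have hex : ∃ k, t k = ⊤ := by
    obtain ⟨k, hk⟩ := S.exists_time_gt h T
    exact ⟨k, by_contra fun hne => hk.not_gt (h.time_lt hne)⟩
  have hfind := Nat.find_spec hex
  have hmin : ∀ j, j < Nat.find hex → ¬ t j = ⊤ := fun j hj => Nat.find_min hex hj
  generalize Nat.find hex = k at hfind hmin
  cases k with
  | zero =>
    rw [h.time_zero] at hfind
    exact absurd hfind EReal.zero_ne_top
  | succ k => exact ⟨k, hmin k k.lt_succ_self, hfind⟩

theorem exists_limit (S : StandingAssumptions f g V α₁ α₂ mu γ η α c σ φ cHat) {T : ℝ}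
    (h : IsEventTriggeredSolution f g (practicalTrigger g V φ η σ cHat) x₀ T x t xh) :
    ∃ z, Tendsto x (𝓝[<] T) (𝓝 z) := by
  obtain ⟨M, hM0, hM⟩ := S.exists_lipschitz h
  have hT : 0 < T := EReal.coe_pos.1 h.pos
  have hlip : LipschitzOnWith M.toNNReal x (Ico 0 T) := by
    refine LipschitzOnWith.of_dist_le_mul fun a ha b hb => ?_
    rw [Real.coe_toNNReal _ hM0, dist_eq_norm, Real.dist_eq]
    rcases le_total a b with hab | hab
    · rw [norm_sub_rev, abs_sub_comm, abs_of_nonneg (sub_nonneg.2 hab)]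
      exact hM a b ha.1 hab (EReal.coe_lt_coe_iff.2 hb.2)
    · rw [abs_of_nonneg (sub_nonneg.2 hab)]
      exact hM b a hb.1 hab (EReal.coe_lt_coe_iff.2 ha.2)
  obtain ⟨x', hx', heq⟩ := hlip.extend_finite_dimension
  refine ⟨x' T, ((hx'.continuous.tendsto T).mono_left nhdsWithin_le_nhds).congr' ?_⟩
  filter_upwards [Ioo_mem_nhdsLT hT] with s hs using (heq (Ioo_subset_Ico_self hs)).symm

end StandingAssumptions

/-! ### Trajectories with generated events, gluing and maximal continuation -/

open Classical in
/-- The event times before `T` and the held states that a trajectory `x` generates. -/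
noncomputable def eventData {N : ℕ} {n : Fin N → ℕ} (Tr : ∀ i, Euc (n i) → Euc (n i) → ℝ)
    (x : ℝ → State n) (T : EReal) : ℕ → EReal × State n
  | 0 => (0, x 0)
  | k + 1 =>
    let p := eventData Tr x T k
    let τ := sInf ((fun s : ℝ => (s : EReal)) '' eventSet Tr x p.1 T p.2)
    (τ, WithLp.toLp 2 fun i => if 0 ≤ Tr i (x τ.toReal i) (p.2 i - x τ.toReal i) then x τ.toReal i
      else p.2 i)

section EventData

variable {N : ℕ} {n : Fin N → ℕ} {Tr : ∀ i, Euc (n i) → Euc (n i) → ℝ} {x x' : ℝ → State n}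
  {T T' : EReal}

theorem eventData_succ_fst (k : ℕ) : (eventData Tr x T (k + 1)).1 =
    sInf ((fun s : ℝ => (s : EReal)) '' eventSet Tr x (eventData Tr x T k).1 T
      (eventData Tr x T k).2) :=
  rfl

theorem eventData_succ_snd {k : ℕ} {s : ℝ} (hs : (eventData Tr x T (k + 1)).1 = s) (i : Fin N) :
    (0 ≤ Tr i (x s i) ((eventData Tr x T k).2 i - x s i) →
      (eventData Tr x T (k + 1)).2 i = x s i) ∧
    (¬ 0 ≤ Tr i (x s i) ((eventData Tr x T k).2 i - x s i) →
      (eventData Tr x T (k + 1)).2 i = (eventData Tr x T k).2 i) := by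
  have h2 : ∀ i, (eventData Tr x T (k + 1)).2 i =
      if 0 ≤ Tr i (x (eventData Tr x T (k + 1)).1.toReal i)
        ((eventData Tr x T k).2 i - x (eventData Tr x T (k + 1)).1.toReal i)
      then x (eventData Tr x T (k + 1)).1.toReal i else (eventData Tr x T k).2 i := fun _ => rfl
  rw [h2, hs, EReal.toReal_coe]
  exact ⟨fun h => if_pos h, fun h => if_neg h⟩

/-- After a time `⊤` all later times are `⊤`, whatever the held state; the value that `eventData`
assigns at `⊤` (through `toReal ⊤ = 0`) is thus immaterial. -/
theorem eventSet_top (h : State n) : eventSet Tr x ⊤ T h = ∅ :=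
  eq_empty_of_forall_notMem fun _ hs => not_top_lt hs.1

theorem sInf_coe_eventSet_eq_top {A : Set ℝ} :
    sInf ((fun s : ℝ => (s : EReal)) '' A) = ⊤ ↔ A = ∅ := by
  refine ⟨fun h => eq_empty_of_forall_notMem fun s hs => ?_, fun h => by simp [h]⟩
  have := sInf_le (mem_image_of_mem (fun s : ℝ => (s : EReal)) hs)
  rw [h] at this
  exact EReal.coe_ne_top s (top_le_iff.1 this)

theorem eventData_monotone : Monotone fun k => (eventData Tr x T k).1 := by
  refine monotone_nat_of_le_succ fun k => ?_
  rw [eventData_succ_fst]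
  refine le_sInf ?_
  rintro _ ⟨s, hs, rfl⟩
  exact hs.1.le

theorem eventData_nonneg (k : ℕ) : 0 ≤ (eventData Tr x T k).1 :=
  eventData_monotone (Tr := Tr) (x := x) (T := T) (Nat.zero_le k)

/-- The events before `T` depend only on the trajectory before `T`. -/
theorem eventData_local (hT : 0 < T) (hTT' : T ≤ T')
    (hx : ∀ s : ℝ, 0 ≤ s → (s : EReal) < T → x' s = x s) (k : ℕ) :
    ((eventData Tr x' T' k).1 < T → eventData Tr x T k = eventData Tr x' T' k) ∧
      (T ≤ (eventData Tr x' T' k).1 → (eventData Tr x T k).1 = ⊤) := by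
  induction k with
  | zero =>
    refine ⟨fun _ => ?_, fun h => absurd h (not_le.2 hT)⟩
    change ((0 : EReal), x 0) = (0, x' 0)
    rw [hx 0 le_rfl hT]
  | succ k ih =>
    rcases lt_or_ge (eventData Tr x' T' k).1 T with hk | hk
    · have hset : eventSet Tr x (eventData Tr x T k).1 T (eventData Tr x T k).2 =
          eventSet Tr x' (eventData Tr x' T' k).1 T' (eventData Tr x' T' k).2 ∩
            {s : ℝ | (s : EReal) < T} := by
        rw [ih.1 hk]
        ext s
        have key : (eventData Tr x' T' k).1 < s → (s : EReal) < T → x' s = x s := fun h1 h2 =>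
          hx s (EReal.coe_nonneg.1 ((eventData_nonneg k).trans h1.le)) h2
        constructor
        · rintro ⟨h1, h2, h3⟩
          exact ⟨⟨h1, h2.trans_le hTT', by rwa [key h1 h2]⟩, h2⟩
        · rintro ⟨⟨h1, -, h3⟩, h2⟩
          exact ⟨h1, h2, by rwa [← key h1 h2]⟩
      constructor
      · intro hlt
        have h1 : (eventData Tr x T (k + 1)).1 = (eventData Tr x' T' (k + 1)).1 := by
          rw [eventData_succ_fst] at hlt
          rw [eventData_succ_fst, eventData_succ_fst, hset]
          refine le_antisymm (le_sInf ?_) (sInf_le_sInf (image_mono inter_subset_left))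
          rintro _ ⟨s, hs, rfl⟩
          rcases lt_or_ge (s : EReal) T with hsT | hsT
          · exact sInf_le (mem_image_of_mem _ ⟨hs, hsT⟩)
          · obtain ⟨_, ⟨r, hr, rfl⟩, hrT⟩ := sInf_lt_iff.1 hlt
            exact le_trans (sInf_le (mem_image_of_mem _ ⟨hr, hrT⟩)) (hrT.le.trans hsT)
        have h0 := eventData_nonneg (Tr := Tr) (x := x') (T := T') (k + 1)
        obtain ⟨s, hs⟩ : ∃ s : ℝ, (eventData Tr x' T' (k + 1)).1 = s := by
          lift (eventData Tr x' T' (k + 1)).1 to ℝ using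
            ⟨hlt.ne_top, (EReal.bot_lt_zero.trans_le h0).ne'⟩ with s
          exact ⟨s, rfl⟩
        rw [hs] at h0 hlt
        refine Prod.ext h1 ?_
        have hxs := hx s (EReal.coe_nonneg.1 h0) hlt
        ext1 i
        have hs' := h1.trans hs
        have e1 := eventData_succ_snd hs' i
        have e2 := eventData_succ_snd hs i
        rw [ih.1 hk, ← hxs] at e1
        by_cases hc : 0 ≤ Tr i (x' s i) ((eventData Tr x' T' k).2 i - x' s i)
        · rw [e1.1 hc, e2.1 hc]
        · rw [e1.2 hc, e2.2 hc]
      · intro hle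
        rw [eventData_succ_fst, sInf_coe_eventSet_eq_top, hset]
        refine eq_empty_of_forall_notMem fun s hs => ?_
        rw [eventData_succ_fst] at hle
        exact (hle.trans (sInf_le (mem_image_of_mem _ hs.1))).not_gt hs.2
    · refine ⟨fun hlt => absurd (hk.trans (eventData_monotone k.le_succ)) (not_le.2 hlt),
        fun _ => ?_⟩
      rw [eventData_succ_fst, ih.2 hk, eventSet_top, sInf_coe_eventSet_eq_top]

end EventData

/-- `x` is a solution, with the event times and held states that it generates. -/
def IsClosedLoopTrajectory {N : ℕ} {n m : Fin N → ℕ} (f : ∀ i, State n → Euc (m i) → Euc (n i))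
    (g : ∀ i, State n → Euc (m i)) (Tr : ∀ i, Euc (n i) → Euc (n i) → ℝ) (x₀ : State n) (T : EReal)
    (x : ℝ → State n) : Prop :=
  IsEventTriggeredSolution f g Tr x₀ T x (fun k => (eventData Tr x T k).1)
    fun k => (eventData Tr x T k).2

section Trajectories

variable {N : ℕ} {n m : Fin N → ℕ}
  {f : ∀ i, State n → Euc (m i) → Euc (n i)} {g : ∀ i, State n → Euc (m i)}
  {Tr : ∀ i, Euc (n i) → Euc (n i) → ℝ} {x₀ : State n} {T : EReal}
  {x : ℝ → State n}

theorem isClosedLoopTrajectory_of (hT : 0 < T) (hinit : x 0 = x₀)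
    (hc : ContinuousOn x {s : ℝ | 0 ≤ s ∧ (s : EReal) < T})
    (hcov : ∀ s : ℝ, (s : EReal) < T → ∃ k, (s : EReal) < (eventData Tr x T k).1)
    (hode : ∀ (k : ℕ) (s : ℝ), (eventData Tr x T k).1 < s →
      (s : EReal) < (eventData Tr x T (k + 1)).1 → (s : EReal) < T →
      HasDerivAt x (heldField f g (x s) (eventData Tr x T k).2) s) :
    IsClosedLoopTrajectory f g Tr x₀ T x where
  pos := hT
  init := hinit
  continuousOn := hc
  time_zero := rfl
  held_zero := hinit
  time_succ _ := rfl
  held_succ _ _ hs i := eventData_succ_snd hs i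
  covered := hcov
  ode k s h1 h2 h3 := hasDerivAt_state_iff.1 (hode k s h1 h2 h3)

/-- The triggering rule determines the event times from `x`, and the held states too as long as the
event time is finite; beyond that they are arbitrary and do not matter. -/
theorem IsEventTriggeredSolution.isClosedLoopTrajectory {t : ℕ → EReal} {xh : ℕ → State n}
    (h : IsEventTriggeredSolution f g Tr x₀ T x t xh) : IsClosedLoopTrajectory f g Tr x₀ T x := by
  have key : ∀ k, t k = (eventData Tr x T k).1 ∧ (t k ≠ ⊤ → xh k = (eventData Tr x T k).2) := by
    intro k
    induction k with
    | zero => exact ⟨h.time_zero, fun _ => h.held_zero.trans h.init.symm⟩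
    | succ k ih =>
      have h1 : t (k + 1) = (eventData Tr x T (k + 1)).1 := by
        rw [h.time_succ', eventData_succ_fst, ← ih.1]
        by_cases hk : t k = ⊤
        · rw [hk, eventSet_top, eventSet_top]
        · rw [ih.2 hk]
      refine ⟨h1, fun hne => ?_⟩
      obtain ⟨s, hs, -, -⟩ := h.exists_real_time hne
      have hk : t k ≠ ⊤ := fun htop =>
        hne (top_le_iff.1 (htop.symm.le.trans (h.time_monotone k.le_succ)))
      ext1 i
      have e1 := h.held_succ k s hs i
      have e2 := eventData_succ_snd (h1.symm.trans hs) i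
      rw [← ih.2 hk] at e2
      by_cases hc : 0 ≤ Tr i (x s i) (xh k i - x s i)
      · rw [e1.1 hc, e2.1 hc]
      · rw [e1.2 hc, e2.2 hc]
  refine isClosedLoopTrajectory_of h.pos h.init h.continuousOn (fun s hs => ?_)
    fun k s h1 h2 h3 => ?_
  · obtain ⟨k, hk⟩ := h.covered s hs
    exact ⟨k, (key k).1 ▸ hk⟩
  · rw [← (key k).1] at h1
    rw [← (key (k + 1)).1] at h2
    rw [← (key k).2 (h1.trans (EReal.coe_lt_top s)).ne]
    exact hasDerivAt_state_iff.2 (h.ode k s h1 h2 h3)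

theorem IsClosedLoopTrajectory.hasDerivAt_of_agree {T' : EReal} {x' : ℝ → State n}
    (h : IsClosedLoopTrajectory f g Tr x₀ T' x') (hT' : T' ≤ T)
    (heq : ∀ r : ℝ, 0 ≤ r → (r : EReal) < T' → x r = x' r) {k : ℕ} {s : ℝ}
    (hsT' : (s : EReal) < T') (h1 : (eventData Tr x T k).1 < s)
    (h2 : (s : EReal) < (eventData Tr x T (k + 1)).1) :
    HasDerivAt x (heldField f g (x s) (eventData Tr x T k).2) s := by
  have hs0 : 0 < s := EReal.coe_pos.1 ((eventData_nonneg k).trans_lt h1)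
  have hk := (eventData_local h.pos hT' heq k).1 (h1.trans hsT')
  have hk1 : (s : EReal) < (eventData Tr x' T' (k + 1)).1 := by
    rcases lt_or_ge (eventData Tr x T (k + 1)).1 T' with hlt | hge
    · rwa [(eventData_local h.pos hT' heq (k + 1)).1 hlt]
    · rw [(eventData_local h.pos hT' heq (k + 1)).2 hge]
      exact EReal.coe_lt_top s
  have hder : HasDerivAt x' (heldField f g (x' s) (eventData Tr x' T' k).2) s :=
    hasDerivAt_state_iff.2 (h.ode k s (by rw [hk]; exact h1) hk1 hsT')
  rw [hk, ← heq s hs0.le hsT'] at hder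
  refine hder.congr_of_eventuallyEq ?_
  have hopen : {r : ℝ | (r : EReal) < T'} ∈ 𝓝 s :=
    (isOpen_Iio.preimage continuous_coe_real_ereal).mem_nhds hsT'
  filter_upwards [hopen, lt_mem_nhds hs0] with r h4 h5 using heq r h5.le h4

/-- By `eventData_local`, being a solution up to a given time involves the trajectory only up to
that time. This lets the union of a chain of solutions be a solution. -/
theorem IsClosedLoopTrajectory.of_local (hT : 0 < T)
    (hloc : ∀ s : ℝ, (s : EReal) < T → ∃ (T' : EReal) (x' : ℝ → State n), (s : EReal) < T' ∧
      T' ≤ T ∧ IsClosedLoopTrajectory f g Tr x₀ T' x' ∧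
      ∀ r : ℝ, 0 ≤ r → (r : EReal) < T' → x r = x' r) :
    IsClosedLoopTrajectory f g Tr x₀ T x := by
  refine isClosedLoopTrajectory_of hT ?_ ?_ ?_ ?_
  · obtain ⟨T', x', hs, hT', h, heq⟩ := hloc 0 hT
    rw [heq 0 le_rfl hs, h.init]
  · rintro s ⟨hs0, hs⟩
    obtain ⟨T', x', hsT', hT', h, heq⟩ := hloc s hs
    have hopen : {r : ℝ | (r : EReal) < T'} ∈ 𝓝 s :=
      (isOpen_Iio.preimage continuous_coe_real_ereal).mem_nhds hsT'
    have h1 : ContinuousWithinAt x {r : ℝ | 0 ≤ r ∧ (r : EReal) < T'} s :=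
      (h.continuousOn s ⟨hs0, hsT'⟩).congr (fun r hr => heq r hr.1 hr.2) (heq s hs0 hsT')
    refine h1.mono_of_mem_nhdsWithin ?_
    filter_upwards [self_mem_nhdsWithin, mem_nhdsWithin_of_mem_nhds hopen] with r h2 h3
      using ⟨h2.1, h3⟩
  · intro s hs
    obtain ⟨T', x', hsT', hT', h, heq⟩ := hloc s hs
    obtain ⟨k, hk⟩ := h.covered s hsT'
    refine ⟨k, ?_⟩
    rcases lt_or_ge (eventData Tr x T k).1 T' with hlt | hge
    · rwa [← (eventData_local h.pos hT' heq k).1 hlt]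
    · exact hsT'.trans_le hge
  · intro k s h1 h2 h3
    obtain ⟨T', x', hsT', hT', h, heq⟩ := hloc s h3
    exact h.hasDerivAt_of_agree hT' heq hsT' h1 h2

/-- Trajectories that cannot be stopped at a finite time extend to `[0, ∞)`. -/
theorem IsClosedLoopTrajectory.exists_global
    (hext : ∀ (T : ℝ) (x : ℝ → State n), IsClosedLoopTrajectory f g Tr x₀ T x →
      ∃ (T' : ℝ) (x' : ℝ → State n), T < T' ∧ IsClosedLoopTrajectory f g Tr x₀ T' x' ∧
        ∀ r : ℝ, 0 ≤ r → r < T → x' r = x r)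
    (h : IsClosedLoopTrajectory f g Tr x₀ T x) :
    ∃ x' : ℝ → State n, IsClosedLoopTrajectory f g Tr x₀ ⊤ x' ∧
      ∀ r : ℝ, 0 ≤ r → (r : EReal) < T → x' r = x r := by
  classical
  let X := {p : EReal × (ℝ → State n) // T ≤ p.1 ∧ IsClosedLoopTrajectory f g Tr x₀ p.1 p.2 ∧
    ∀ r : ℝ, 0 ≤ r → (r : EReal) < T → p.2 r = x r}
  let rel : X → X → Prop := fun p q => p.1.1 ≤ q.1.1 ∧
    ∀ r : ℝ, 0 ≤ r → (r : EReal) < p.1.1 → q.1.2 r = p.1.2 r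
  have hchain : ∀ C : Set X, IsChain rel C → ∃ ub, ∀ p ∈ C, rel p ub := by
    intro C hC
    rcases C.eq_empty_or_nonempty with rfl | ⟨p₀, hp₀⟩
    · exact ⟨⟨(T, x), le_rfl, h, fun _ _ _ => rfl⟩, by simp⟩
    let S : EReal := sSup ((fun p : X => p.1.1) '' C)
    have hle : ∀ p ∈ C, p.1.1 ≤ S := fun p hp => le_sSup (mem_image_of_mem _ hp)
    let y : ℝ → State n := fun s =>
      if hs : ∃ p ∈ C, (s : EReal) < p.1.1 then hs.choose.1.2 s else 0
    have hy : ∀ p ∈ C, ∀ r : ℝ, 0 ≤ r → (r : EReal) < p.1.1 → y r = p.1.2 r := by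
      intro p hp r hr hrp
      have hs : ∃ p ∈ C, (r : EReal) < p.1.1 := ⟨p, hp, hrp⟩
      simp only [y, dif_pos hs]
      have hq := hs.choose_spec
      generalize hs.choose = q at hq
      by_cases hpq : p = q
      · rw [hpq]
      · rcases hC hp hq.1 hpq with h1 | h1
        · exact h1.2 r hr hrp
        · exact (h1.2 r hr hq.2).symm
    have hTS : T ≤ S := p₀.2.1.trans (hle p₀ hp₀)
    refine ⟨⟨(S, y), hTS, ?_, fun r hr hrT => ?_⟩, fun p hp => ⟨hle p hp, hy p hp⟩⟩
    · refine IsClosedLoopTrajectory.of_local (h.pos.trans_le hTS) fun s hs => ?_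
      obtain ⟨_, ⟨p, hp, rfl⟩, hsp⟩ := lt_sSup_iff.1 hs
      exact ⟨p.1.1, p.1.2, hsp, hle p hp, p.2.2.1, hy p hp⟩
    · rw [← p₀.2.2.2 r hr hrT]
      exact hy p₀ hp₀ r hr (hrT.trans_le p₀.2.1)
  have htrans : ∀ {p q r : X}, rel p q → rel q r → rel p r := fun h1 h2 =>
    ⟨h1.1.trans h2.1, fun s hs hsp => (h2.2 s hs (hsp.trans_le h1.1)).trans (h1.2 s hs hsp)⟩
  obtain ⟨⟨⟨S, y⟩, hTS, hy, hyx⟩, hmax⟩ := exists_maximal_of_chains_bounded hchain htrans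
  dsimp only at hTS hy hyx
  by_cases hS : S = ⊤
  · subst hS
    exact ⟨y, hy, hyx⟩
  · lift S to ℝ using ⟨hS, (EReal.bot_lt_zero.trans hy.pos).ne'⟩
    obtain ⟨S', y', hSS', hy', heq⟩ := hext S y hy
    have hlt : (S : EReal) < S' := EReal.coe_lt_coe_iff.2 hSS'
    have hyy : ∀ r : ℝ, 0 ≤ r → (r : EReal) < S → y' r = y r := fun r hr hrS =>
      heq r hr (EReal.coe_lt_coe_iff.1 hrS)
    have := (hmax ⟨(S', y'), hTS.trans hlt.le, hy', fun r hr hrT =>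
      (hyy r hr (hrT.trans_le hTS)).trans (hyx r hr hrT)⟩ ⟨hlt.le, hyy⟩).1
    exact absurd hlt (not_lt.2 this)

end Trajectories

/-! ### Local existence and continuation past a finite time -/

theorem hasDerivWithinAt_Iic_of_hasDerivAt_Ioo {E : Type*} [NormedAddCommGroup E] [NormedSpace ℝ E]
    {x : ℝ → E} {F : E → E} (hF : Continuous F) {a b : ℝ} (hab : a < b)
    (hx : Tendsto x (𝓝[<] b) (𝓝 (x b))) (hder : ∀ s ∈ Ioo a b, HasDerivAt x (F (x s)) s) :
    HasDerivWithinAt x (F (x b)) (Iic b) b := by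
  refine hasDerivWithinAt_Iic_of_tendsto_deriv (s := Ioo a b)
    (fun s hs => (hder s hs).differentiableAt.differentiableWithinAt)
    (hx.mono_left (nhdsWithin_mono _ Ioo_subset_Iio_self)) (Ioo_mem_nhdsLT hab) ?_
  refine ((hF.tendsto (x b)).comp hx).congr' ?_
  filter_upwards [Ioo_mem_nhdsLT hab] with s hs using (hder s hs).deriv.symm

/-- A short untriggered motion with constant held state. -/
theorem exists_untriggered_start {N : ℕ} {n m : Fin N → ℕ}
    {f : ∀ i, State n → Euc (m i) → Euc (n i)} (g : ∀ i, State n → Euc (m i))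
    {Tr : ∀ i, Euc (n i) → Euc (n i) → ℝ} (hsolv : LocallySolvable f)
    (hTc : ∀ i, Continuous fun p : Euc (n i) × Euc (n i) => Tr i p.1 p.2) {z h : State n}
    (hneg : ∀ i, Tr i (z i) (h i - z i) < 0) :
    ∃ (δ : ℝ) (y : ℝ → State n), 0 < δ ∧ y 0 = z ∧ ContinuousOn y (Ico 0 δ) ∧
      (∀ s ∈ Ioo 0 δ, HasDerivAt y (heldField f g (y s) h) s) ∧
      ∀ s ∈ Ico 0 δ, ∀ i, Tr i (y s i) (h i - y s i) < 0 := by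
  obtain ⟨δ, hδ, y, hy0, hyc, hyd⟩ := hsolv z fun i => g i h
  have hlim : Tendsto y (𝓝[≥] 0) (𝓝 (y 0)) := by
    have := hyc 0 ⟨le_rfl, hδ⟩
    rwa [ContinuousWithinAt, nhdsWithin_Ico_eq_nhdsGE hδ] at this
  obtain ⟨b, hb, hsub⟩ := mem_nhdsGE_iff_exists_Ico_subset.1
    (eventually_trigger_neg hTc hlim (h := h) (by rwa [hy0]))
  have hb0 : (0 : ℝ) < b := hb
  refine ⟨min δ b, y, lt_min hδ hb0, hy0,
    hyc.mono (Ico_subset_Ico_right (min_le_left _ _)), fun s hs => ?_, fun s hs => ?_⟩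
  · exact hasDerivAt_state_iff.2 (hyd s ⟨hs.1, hs.2.trans_le (min_le_left _ _)⟩)
  · exact hsub ⟨hs.1, hs.2.trans_le (min_le_right _ _)⟩

namespace StandingAssumptions

variable {N : ℕ} {n m : Fin N → ℕ}
  {f : ∀ i, State n → Euc (m i) → Euc (n i)} {g : ∀ i, State n → Euc (m i)}
  {V : ∀ i, Euc (n i) → ℝ≥0} {α₁ α₂ : Fin N → ℝ≥0 → ℝ≥0}
  {mu : Fin N → (Fin N ⊕ Fin N → ℝ≥0) → ℝ≥0} {γ η : Fin N → Fin N → ℝ≥0 → ℝ≥0}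
  {α : Fin N → ℝ≥0 → ℝ≥0} {c : Fin N → ℝ≥0}
  {σ : Fin N → ℝ≥0 → ℝ≥0} {φ : Fin N → Fin N → ℝ≥0 → ℝ≥0} {cHat : Fin N → ℝ≥0}

theorem exists_local_trajectory (S : StandingAssumptions f g V α₁ α₂ mu γ η α c σ φ cHat)
    (x₀ : State n) : ∃ (T : ℝ) (x : ℝ → State n),
      IsClosedLoopTrajectory f g (practicalTrigger g V φ η σ cHat) x₀ T x := by
  obtain ⟨δ, y, hδ, hy0, hyc, hyd, hyn⟩ := exists_untriggered_start g S.locallySolvable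
    S.continuous_trigger (z := x₀) (h := x₀) fun i => by
      rw [sub_self]; exact S.trigger_zero_neg i _
  have h1 : (eventData (practicalTrigger g V φ η σ cHat) y δ 1).1 = ⊤ := by
    rw [eventData_succ_fst, sInf_coe_eventSet_eq_top]
    refine eq_empty_of_forall_notMem fun s hs => ?_
    obtain ⟨i, hi⟩ := hs.2.2
    refine (hyn s ⟨(EReal.coe_pos.1 hs.1).le, EReal.coe_lt_coe_iff.1 hs.2.1⟩ i).not_ge ?_
    rwa [← hy0]
  refine ⟨δ, y, isClosedLoopTrajectory_of (EReal.coe_pos.2 hδ) hy0 (hyc.mono fun s hs =>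
    ⟨hs.1, EReal.coe_lt_coe_iff.1 hs.2⟩) (fun s _ => ⟨1, h1 ▸ EReal.coe_lt_top s⟩) ?_⟩
  intro k s hk _ hs
  cases k with
  | zero =>
    change HasDerivAt y (heldField f g (y s) (y 0)) s
    rw [hy0]
    exact hyd s ⟨EReal.coe_pos.1 hk, EReal.coe_lt_coe_iff.1 hs⟩
  | succ k =>
    have := eventData_monotone (Tr := practicalTrigger g V φ η σ cHat) (x := y) (T := δ)
      (show 1 ≤ k + 1 by omega)
    exact absurd ((h1.symm.le.trans this).trans_lt hk) not_top_lt

/-- Velocity is bounded and only finitely many events precede `T`, so there is a limit state `z` and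
a last held state `hh`. A local solution from `z` is appended after the resets due at `T`; on a
short interval it triggers nothing, so `T` is the only possible new event time. -/
theorem exists_extension (S : StandingAssumptions f g V α₁ α₂ mu γ η α c σ φ cHat)
    {x₀ : State n} (T : ℝ) (x : ℝ → State n)
    (h : IsClosedLoopTrajectory f g (practicalTrigger g V φ η σ cHat) x₀ T x) :
    ∃ (T' : ℝ) (x' : ℝ → State n), T < T' ∧
      IsClosedLoopTrajectory f g (practicalTrigger g V φ η σ cHat) x₀ T' x' ∧
      ∀ r : ℝ, 0 ≤ r → r < T → x' r = x r := by
  classical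
  set Tr := practicalTrigger g V φ η σ cHat with hTr
  have hT0 : 0 < T := EReal.coe_pos.1 h.pos
  obtain ⟨z, hz⟩ := S.exists_limit h
  obtain ⟨k, hk, hk1⟩ := S.exists_last_event h
  have hkT := h.time_lt hk
  have hempty := hk1
  rw [eventData_succ_fst, sInf_coe_eventSet_eq_top] at hempty
  obtain ⟨hh, hhdef⟩ : ∃ hh, hh = (eventData Tr x T k).2 := ⟨_, rfl⟩
  let h' : State n := WithLp.toLp 2 fun i => if 0 ≤ Tr i (z i) (hh i - z i) then z i else hh i
  have hneg : ∀ i, Tr i (z i) (h' i - z i) < 0 := by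
    intro i
    by_cases hc : 0 ≤ Tr i (z i) (hh i - z i)
    · simp only [h', if_pos hc, sub_self]
      exact S.trigger_zero_neg i _
    · simpa only [h', if_neg hc] using not_le.1 hc
  obtain ⟨δ, y, hδ, hy0, hyc, hyd, hyn⟩ := exists_untriggered_start g S.locallySolvable
    S.continuous_trigger hneg
  let x' : ℝ → State n := fun s => if s < T then x s else y (s - T)
  have hx'lt : ∀ s, s < T → x' s = x s := fun s hs => if_pos hs
  have hx'ge : ∀ s, T ≤ s → x' s = y (s - T) := fun s hs => if_neg (not_lt.2 hs)
  have hx'T : x' T = z := by rw [hx'ge T le_rfl, sub_self, hy0]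
  have hTT' : (T : EReal) ≤ (T + δ : ℝ) := EReal.coe_le_coe_iff.2 (by linarith)
  have hagree : ∀ r : ℝ, 0 ≤ r → (r : EReal) < T → x' r = x r := fun r _ hr =>
    hx'lt r (EReal.coe_lt_coe_iff.1 hr)
  have hloc := eventData_local (Tr := Tr) h.pos hTT' hagree
  have hDk : eventData Tr x' (T + δ : ℝ) k = eventData Tr x T k := by
    rcases lt_or_ge (eventData Tr x' (T + δ : ℝ) k).1 (T : EReal) with hlt | hge
    · exact ((hloc k).1 hlt).symm
    · exact absurd ((hloc k).2 hge) hk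
  have hDk1 : (T : EReal) ≤ (eventData Tr x' (T + δ : ℝ) (k + 1)).1 := by
    by_contra hcon
    rw [not_le] at hcon
    rw [← (hloc (k + 1)).1 hcon, hk1] at hcon
    exact not_top_lt hcon
  have hDmono := eventData_monotone (Tr := Tr) (x := x') (T := (T + δ : ℝ))
  have hnegx' : ∀ s, T ≤ s → s < T + δ → ∀ i, Tr i (x' s i) (h' i - x' s i) < 0 := by
    intro s hs hs'
    rw [hx'ge s hs]
    exact hyn _ ⟨by linarith, by linarith⟩
  have hderR : ∀ s ∈ Ioo T (T + δ), HasDerivAt x' (heldField f g (x' s) h') s := by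
    intro s hs
    have h1 := (hyd (s - T) ⟨by linarith [hs.1], by linarith [hs.2]⟩).comp_sub_const s T
    rw [hx'ge s hs.1.le]
    refine h1.congr_of_eventuallyEq ?_
    filter_upwards [lt_mem_nhds hs.1] with r hr using hx'ge r hr.le
  have hleft : Tendsto x' (𝓝[<] T) (𝓝 (x' T)) := by
    rw [hx'T]
    refine hz.congr' ?_
    filter_upwards [self_mem_nhdsWithin] with s hs using (hx'lt s hs).symm
  have hright : Tendsto x' (𝓝[>] T) (𝓝 (x' T)) := by
    have h1 : ContinuousOn (fun s => y (s - T)) (Ico T (T + δ)) :=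
      hyc.comp (by fun_prop) fun s hs => ⟨by linarith [hs.1], by linarith [hs.2]⟩
    have h2 := (h1 T ⟨le_rfl, by linarith⟩).mono_left
      (nhdsWithin_mono T (Ioo_subset_Ico_self (a := T) (b := T + δ)))
    rw [nhdsWithin_Ioo_eq_nhdsGT (by linarith)] at h2
    rw [hx'ge T le_rfl]
    refine h2.congr' ?_
    filter_upwards [self_mem_nhdsWithin] with s hs using (hx'ge s (le_of_lt hs)).symm
  -- If a trigger holds at `z`, the event `k + 1` occurs at `T` and no two-sided derivative is
  -- required there. Otherwise `h' = hh`, and `T` is an interior time of the last interval, where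
  -- both one-sided derivatives must agree.
  obtain ⟨hcov, hheld⟩ : (eventData Tr x' (T + δ : ℝ) (k + 2)).1 = ⊤ ∧ ∀ (j : ℕ) (s : ℝ), T ≤ s →
      (eventData Tr x' (T + δ : ℝ) j).1 < s →
      (s : EReal) < (eventData Tr x' (T + δ : ℝ) (j + 1)).1 →
      (eventData Tr x' (T + δ : ℝ) j).2 = h' ∧ (s = T → h' = hh) := by
    by_cases htr : ∃ i, 0 ≤ Tr i (z i) (hh i - z i)
    · have hD1 : (eventData Tr x' (T + δ : ℝ) (k + 1)).1 = T := by
        refine le_antisymm ?_ hDk1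
        rw [eventData_succ_fst, hDk, ← hhdef]
        refine sInf_le (mem_image_of_mem (fun s : ℝ => (s : EReal)) ⟨hkT, ?_, ?_⟩)
        · exact EReal.coe_lt_coe_iff.2 (by linarith)
        · rwa [hx'T]
      have hD1' : (eventData Tr x' (T + δ : ℝ) (k + 1)).2 = h' := by
        ext1 i
        have := eventData_succ_snd hD1 i
        rw [hDk, ← hhdef, hx'T] at this
        by_cases hc : 0 ≤ Tr i (z i) (hh i - z i)
        · rw [this.1 hc]; simp only [h', if_pos hc]
        · rw [this.2 hc]; simp only [h', if_neg hc]
      have hD2 : (eventData Tr x' (T + δ : ℝ) (k + 2)).1 = ⊤ := by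
        rw [eventData_succ_fst, sInf_coe_eventSet_eq_top, hD1, hD1']
        refine eq_empty_of_forall_notMem fun s hs => ?_
        obtain ⟨i, hi⟩ := hs.2.2
        exact (hnegx' s (EReal.coe_lt_coe_iff.1 hs.1).le (EReal.coe_lt_coe_iff.1 hs.2.1) i).not_ge hi
      refine ⟨hD2, fun j s hs h1 h2 => ?_⟩
      rcases lt_trichotomy j (k + 1) with hj | rfl | hj
      · have h3 := hDmono (show j + 1 ≤ k + 1 from hj)
        exact absurd (h2.trans_le (h3.trans hD1.le)) (not_lt.2 (EReal.coe_le_coe_iff.2 hs))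
      · refine ⟨hD1', fun hsT => ?_⟩
        rw [hD1, hsT] at h1
        exact absurd h1 (lt_irrefl _)
      · have h3 := hDmono (show k + 2 ≤ j from hj)
        exact absurd ((hD2.symm.le.trans h3).trans_lt h1) not_top_lt
    · have hh' : h' = hh := by
        push Not at htr
        ext1 i
        simp only [h', if_neg (not_le.2 (htr i))]
      have hD1 : (eventData Tr x' (T + δ : ℝ) (k + 1)).1 = ⊤ := by
        rw [eventData_succ_fst, sInf_coe_eventSet_eq_top, hDk, ← hhdef]
        refine eq_empty_of_forall_notMem fun s hs => ?_
        obtain ⟨h1, h2, i, hi⟩ := hs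
        rcases lt_or_ge s T with hsT | hsT
        · rw [hx'lt s hsT, hhdef] at hi
          exact (hempty ▸ notMem_empty s) ⟨h1, EReal.coe_lt_coe_iff.2 hsT, i, hi⟩
        · have h3 := hnegx' s hsT (EReal.coe_lt_coe_iff.1 h2) i
          rw [hh'] at h3
          exact h3.not_ge hi
      refine ⟨top_le_iff.1 (hD1.symm.le.trans (hDmono (show k + 1 ≤ k + 2 by omega))),
        fun j s hs h1 h2 => ⟨?_, fun _ => hh'⟩⟩
      rcases lt_trichotomy j k with hj | rfl | hj
      · have h3 : (eventData Tr x' (T + δ : ℝ) (j + 1)).1 ≤ (eventData Tr x T k).1 :=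
          (hDmono (show j + 1 ≤ k from hj)).trans (congrArg Prod.fst hDk).le
        exact absurd ((h2.trans_le h3).trans hkT) (not_lt.2 (EReal.coe_le_coe_iff.2 hs))
      · rw [hDk, hh', hhdef]
      · have h3 := hDmono (show k + 1 ≤ j from hj)
        exact absurd ((hD1.symm.le.trans h3).trans_lt h1) not_top_lt
  refine ⟨T + δ, x', by linarith, isClosedLoopTrajectory_of ?_ ?_ ?_ ?_ ?_, fun r _ => hx'lt r⟩
  · exact h.pos.trans_le hTT'
  · rw [hx'lt 0 hT0, h.init]
  · rintro s ⟨hs0, hs⟩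
    rw [EReal.coe_lt_coe_iff] at hs
    rcases lt_trichotomy s T with hsT | rfl | hsT
    · have h1 : ContinuousWithinAt x {s : ℝ | 0 ≤ s ∧ (s : EReal) < T} s :=
        h.continuousOn s ⟨hs0, EReal.coe_lt_coe_iff.2 hsT⟩
      have h2 : ContinuousWithinAt x' {s : ℝ | 0 ≤ s ∧ (s : EReal) < T} s := h1.congr (fun r hr => hagree r hr.1 hr.2) (hx'lt s hsT)
      refine h2.mono_of_mem_nhdsWithin ?_
      filter_upwards [self_mem_nhdsWithin, mem_nhdsWithin_of_mem_nhds (gt_mem_nhds hsT)]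
        with r h3 h4 using ⟨h3.1, EReal.coe_lt_coe_iff.2 h4⟩
    · exact (continuousAt_iff_continuous_left'_right'.2 ⟨hleft, hright⟩).continuousWithinAt
    · exact (hderR s ⟨hsT, hs⟩).continuousAt.continuousWithinAt
  · exact fun s _ => ⟨k + 2, hcov ▸ EReal.coe_lt_top s⟩
  · intro j s h1 h2 h3
    rw [EReal.coe_lt_coe_iff] at h3
    rcases lt_or_ge s T with hsT | hsT
    · exact h.hasDerivAt_of_agree hTT' hagree (EReal.coe_lt_coe_iff.2 hsT) h1 h2
    · obtain ⟨h4, h5⟩ := hheld j s hsT h1 h2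
      rw [h4]
      rcases hsT.eq_or_lt with rfl | hsT
      · have hR := hasDerivWithinAt_Ici_of_hasDerivAt_Ioo
          (continuous_heldField g S.continuous_field h') h3 hright hderR
        obtain ⟨τ, hτ, -, -⟩ := h.exists_real_time hk
        have hτT : τ < T := EReal.coe_lt_coe_iff.1 (hτ ▸ hkT)
        have hL := hasDerivWithinAt_Iic_of_hasDerivAt_Ioo
          (continuous_heldField g S.continuous_field h') hτT hleft fun s hs => by
            have hsT : (s : EReal) < T := EReal.coe_lt_coe_iff.2 hs.2
            rw [h5 rfl, hhdef, hx'lt s hs.2]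
            refine (hasDerivAt_state_iff.2 (h.ode k s (hτ ▸ EReal.coe_lt_coe_iff.2 hs.1) ?_
              hsT)).congr_of_eventuallyEq ?_
            · simp only [hk1]
              exact EReal.coe_lt_top s
            · filter_upwards [gt_mem_nhds hs.2] with r hr using hx'lt r hr
        have := hL.union hR
        rwa [Iic_union_Ici, hasDerivWithinAt_univ] at this
      · exact hderR s ⟨hsT, h3⟩

end StandingAssumptions

/-! ### Global continuation and practical stability -/

namespace StandingAssumptions

variable {N : ℕ} {n m : Fin N → ℕ}
  {f : ∀ i, State n → Euc (m i) → Euc (n i)} {g : ∀ i, State n → Euc (m i)}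
  {V : ∀ i, Euc (n i) → ℝ≥0} {α₁ α₂ : Fin N → ℝ≥0 → ℝ≥0}
  {mu : Fin N → (Fin N ⊕ Fin N → ℝ≥0) → ℝ≥0} {γ η : Fin N → Fin N → ℝ≥0 → ℝ≥0}
  {α : Fin N → ℝ≥0 → ℝ≥0} {c : Fin N → ℝ≥0}
  {σ : Fin N → ℝ≥0 → ℝ≥0} {φ : Fin N → Fin N → ℝ≥0 → ℝ≥0} {cHat : Fin N → ℝ≥0}

theorem exists_global_extension (S : StandingAssumptions f g V α₁ α₂ mu γ η α c σ φ cHat)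
    {x₀ : State n} {T : EReal} {x : ℝ → State n} {t : ℕ → EReal} {xh : ℕ → State n}
    (h : IsEventTriggeredSolution f g (practicalTrigger g V φ η σ cHat) x₀ T x t xh) :
    ∃ x' : ℝ → State n,
      IsClosedLoopTrajectory f g (practicalTrigger g V φ η σ cHat) x₀ ⊤ x' ∧
        ∀ r : ℝ, 0 ≤ r → (r : EReal) < T → x' r = x r :=
  h.isClosedLoopTrajectory.exists_global S.exists_extension

theorem isGloballyUniformlyPracticallyStable
    (S : StandingAssumptions f g V α₁ α₂ mu γ η α c σ φ cHat) :
    IsGloballyUniformlyPracticallyStable f g (practicalTrigger g V φ η σ cHat)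
      (residualRadius α₁ σ c cHat) := by
  let D : ℝ≥0 → ℝ≥0 := fun w => NNReal.sqrt (∑ i, kinv (α₁ i) (σ i w) ^ 2)
  let ω : ℝ≥0 → ℝ≥0 := fun r => Finset.univ.sup fun i => kinv (σ i) (α₂ i r)
  have hDK : ∀ i, IsClassKInf fun w => kinv (α₁ i) (σ i w) := fun i =>
    (S.iss.lower_class i).isClassKInf_kinv.comp (S.sigma_class i)
  have hωK : ∀ i, IsClassKInf fun r => kinv (σ i) (α₂ i r) := fun i =>
    (S.sigma_class i).isClassKInf_kinv.comp (S.iss.upper_class i)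
  have hDc : Continuous D := NNReal.continuous_sqrt.comp
    (continuous_finsetSum _ fun i _ => (hDK i).continuous.pow 2)
  have hDm : Monotone D := fun v w hvw =>
    NNReal.sqrt_le_sqrt.2 (Finset.sum_le_sum fun i _ => by
      gcongr
      exact (hDK i).strictMono.monotone hvw)
  have hωc : Continuous ω := Continuous.finset_sup_apply fun i _ => (hωK i).continuous
  have hωm : Monotone ω := fun r s hrs =>
    Finset.sup_mono_fun fun i _ => (hωK i).strictMono.monotone hrs
  have hω0 : ω 0 = 0 :=
    le_antisymm (Finset.sup_le fun i _ => (hωK i).map_zero.le) zero_le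
  have hD0 : D 0 = 0 := by simp [D, (hDK _).map_zero]
  have hlyap : ∀ x, lyap V σ x ≤ ω ‖x‖₊ := fun x => Finset.sup_mono_fun fun i _ =>
    (S.sigma_class i).kinv_strictMono.monotone ((S.iss.upper i _).trans
      ((S.iss.upper_class i).strictMono.monotone (PiLp.nnnorm_apply_le x i)))
  set d := residualRadius α₁ σ c cHat
  set ℓ := residualLevel σ c cHat
  -- The quantity to be majorized is the excess of `‖x t‖₊` over the residual radius, truncated at
  -- zero. If the initial level is at most `ℓ`, invariance makes it vanish, so the bound `D (ω r)`
  -- has no constant term.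
  let R : ℝ≥0 → ℝ≥0 → ℝ≥0 → Prop := fun r t e => ∃ (x₀ : State n) (x : ℝ → State n), ‖x₀‖₊ = r ∧
    IsClosedLoopTrajectory f g (practicalTrigger g V φ η σ cHat) x₀ ⊤ x ∧ e = ‖x t‖₊ - d
  have hbd : ∀ r t e, R r t e → e ≤ D (ω r) := by
    rintro _ t _ ⟨x₀, x, rfl, hx, rfl⟩
    rw [tsub_le_iff_right]
    have h1 := S.norm_le_of_lyap_le
      (S.lyap_le_along_solution hx t.coe_nonneg (EReal.coe_lt_top t))
    rcases le_total (lyap V σ x₀) ℓ with hle | hle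
    · rw [max_eq_right hle] at h1
      exact h1.trans le_add_self
    · rw [max_eq_left hle] at h1
      exact (h1.trans (hDm (hlyap x₀))).trans le_self_add
  have hconv : ∀ r ε, 0 < ε → ∃ T, ∀ r' ≤ r, ∀ t ≥ T, ∀ e, R r' t e → e ≤ ε := by
    intro r ε hε
    have hev : ∀ᶠ b in 𝓝[>] ℓ, D b < d + ε :=
      ((hDc.tendsto ℓ).mono_left nhdsWithin_le_nhds).eventually_lt_const
        (lt_add_of_pos_right _ hε)
    -- Attraction is available only to levels `b > ℓ`; continuity of `D` at `ℓ`, where `D ℓ = d`,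
    -- absorbs the gap into `ε`.
    obtain ⟨b, hb, hℓb⟩ := (hev.and self_mem_nhdsWithin).exists
    obtain ⟨T, hT⟩ := S.exists_uniform_time (max (ω r) ℓ) hℓb (S.isCompact_lyap_le (max (ω r) ℓ))
    refine ⟨T, ?_⟩
    rintro _ hr t ht _ ⟨x₀, x, rfl, hx, rfl⟩
    have hx₀ : lyap V σ x₀ ≤ ω r := (hlyap x₀).trans (hωm hr)
    have h1 := hT x (fun t => S.isUntriggeredArc_solution hx (max_le_max_right _ hx₀)
      (EReal.coe_lt_top t)) (by rw [hx.init]; exact hx₀.trans (le_max_left _ _)) t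
      (NNReal.coe_le_coe.2 ht)
    rw [tsub_le_iff_right, add_comm]
    exact (S.norm_le_of_lyap_le h1).trans hb.le
  obtain ⟨β, hβ, hbound⟩ := exists_isClassKL_majorant (hDc.comp hωc) (hDm.comp hωm)
    (by simp only [Function.comp_apply, hω0, hD0]) hbd hconv
  refine ⟨β, hβ, fun x₀ T x t xh h s hs => ?_⟩
  -- The uniform attraction time is stated for arcs on all of `[0, ∞)`, so a solution on `[0, T)` is
  -- first extended.
  obtain ⟨x', hx', heq⟩ := S.exists_global_extension h
  rw [← heq s s.coe_nonneg hs, ← tsub_le_iff_right]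
  exact hbound _ _ _ ⟨x₀, x', rfl, hx', rfl⟩

end StandingAssumptions

theorem theoremt5 {N : ℕ} {n m : Fin N → ℕ}
    (f : ∀ i, State n → Euc (m i) → Euc (n i)) (g : ∀ i, State n → Euc (m i))
    (hf : ∀ i, Continuous fun p : State n × Euc (m i) => f i p.1 p.2)
    (hsolv : LocallySolvable f)
    (hg : ∀ i, BoundedOnCompacts (g i))
    (V : ∀ i, Euc (n i) → ℝ≥0) (α₁ α₂ : Fin N → ℝ≥0 → ℝ≥0)
    (mu : Fin N → (Fin N ⊕ Fin N → ℝ≥0) → ℝ≥0) (γ η : Fin N → Fin N → ℝ≥0 → ℝ≥0)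
    (α : Fin N → ℝ≥0 → ℝ≥0) (c : Fin N → ℝ≥0)
    (hISS : PracticalISS f g V α₁ α₂ mu γ η α c)
    (σ : Fin N → ℝ≥0 → ℝ≥0) (φ : Fin N → Fin N → ℝ≥0 → ℝ≥0)
    (hgain : SmallGainWithErrors mu γ σ φ)
    (hφ : ∀ i j, i ∈ receivers g j → IsClassKInf (φ i j))
    (cHat : Fin N → ℝ≥0) (hcHat : ∀ i, 0 < cHat i) :
    (∀ x₀ : State n, ∃ (x : ℝ → State n) (t : ℕ → EReal) (xh : ℕ → State n),
      IsEventTriggeredSolution f g (practicalTrigger g V φ η σ cHat) x₀ ⊤ x t xh) ∧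
    (∀ (x₀ : State n) (T : EReal) (x : ℝ → State n) (t : ℕ → EReal) (xh : ℕ → State n),
      IsEventTriggeredSolution f g (practicalTrigger g V φ η σ cHat) x₀ T x t xh →
        ¬ IsZeno t ∧
        ∃ (x' : ℝ → State n) (t' : ℕ → EReal) (xh' : ℕ → State n),
          IsEventTriggeredSolution f g (practicalTrigger g V φ η σ cHat) x₀ ⊤ x' t' xh' ∧
            ∀ s : ℝ, 0 ≤ s → (s : EReal) < T → x' s = x s) ∧
    IsGloballyUniformlyPracticallyStable f g (practicalTrigger g V φ η σ cHat)
      (residualRadius α₁ σ c cHat) := by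
  have S : StandingAssumptions f g V α₁ α₂ mu γ η α c σ φ cHat :=
    ⟨hf, hsolv, hg, hISS, hgain, hφ, hcHat⟩
  refine ⟨fun x₀ => ?_, fun x₀ T x t xh h => ⟨h.not_isZeno (S.exists_time_gt h), ?_⟩,
    S.isGloballyUniformlyPracticallyStable⟩
  · obtain ⟨T, x, hx⟩ := S.exists_local_trajectory x₀
    obtain ⟨x', hx', -⟩ := S.exists_global_extension hx
    exact ⟨x', _, _, hx'⟩
  · obtain ⟨x', hx', heq⟩ := S.exists_global_extension h
    exact ⟨x', _, _, hx', heq⟩
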